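/- Let $p>1$, $p'=\frac{p}{p-1}$, $\theta\in(0,1)$. Let $D\in C^1(0,1)$ with $D>0$ in $(0,1)$ (possibly singular or degenerate at $0$ and $1$), let $h\in C[0,1]$, $H(u)=\int_0^u h(s)\,ds$, $h_m=\min_{[0,1]}h$, and let $g\in C[0,1]$ satisfy $g=0$ on $[0,\theta]$, $g>0$ on $(\theta,1)$, $g(1)=0$. Assume $\int_0^1 D^{p'-1}(u)g(u)\,du<+\infty$. Put $$k(p)=\begin{cases}\dfrac{1}{2^{p'-1}-1}, & 1<p<2,\\[2mm] 1, & p=2,\\[1mm] \dfrac{p'}{p'-1+\hat k}, & p>2,\end{cases}\qquad \hat k=\frac{1+p'(p'-1)^{\frac1{p'-2}}+(p'-1)^{\frac{p'}{p'-2}}}{\bigl(1+(p'-1)^{\frac1{p'-2}}\bigr)^{p'}} .$$ For $c\in\mathbb R$ consider the problem $$\bigl(D(u)|u'|^{p-2}u'\bigr)'+(c+h(u))u'+g(u)=0,\qquad u(-\infty)=1,\quad u(+\infty)=0. \tag{P}$$ A solution of (P) is a continuous function $u:\mathbb R\to[0,1]$ such that, with $I_u=\{\xi: 0<u(\xi)<1\}$: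 (a) $u\in C^1(I_u)$ and the equation holds at every point of $I_u$; (b) the flux $\xi\mapsto D(u(\xi))|u'(\xi)|^{p-2}u'(\xi)$ (understood as $0$ where $u(\xi)\in\{0,1\}$) is continuous on $\mathbb R$ and tends to $0$ as $u(\xi)\to0$ and as $u(\xi)\to1$; (c) $u(\xi)\to1$ as $\xi\to-\infty$ and $u(\xi)\to0$ as $\xi\to+\infty$. Theorem. If $$H(1)\le h_m+\Bigl(k(p)\int_0^1D^{p'-1}(u)g(u)\,du\Bigr)^{1/p'},$$ then there is exactly one $c=c^*>-h_m$ for which (P) has a solution; for $c=c^*$ the solution is unique up to translation and is strictly decreasing on $I_u$; and $$c^*<\frac1\theta\Bigl[\Bigl(p'\int_0^1D^{p'-1}(u)g(u)\,du\Bigr)^{1/p'}-H(\theta)\Bigr].$$ -/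

import Mathlib

open Set Filter Topology MeasureTheory

namespace CombustionWave

noncomputable section


/-- The flux function `H(u) = ∫₀ᵘ h(s) ds` with convective velocity `h`. -/
def fluxH (h : ℝ → ℝ) (u : ℝ) : ℝ := ∫ s in (0 : ℝ)..u, h s

/-- `h_m`, the minimum of `h` over `[0,1]` (attained when `h` is continuous there). -/
def hMin (h : ℝ → ℝ) : ℝ := sInf (h '' Icc 0 1)

/-- The function `f = D^(p'-1) g`. -/
def weight (p : ℝ) (D g : ℝ → ℝ) (u : ℝ) : ℝ := D u ^ (Real.conjExponent p - 1) * g u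

/-- The constant `k(p)`, with `p' = p / (p - 1)` the conjugate exponent. -/
def kConst (p : ℝ) : ℝ :=
  if p < 2 then 1 / ((2 : ℝ) ^ (Real.conjExponent p - 1) - 1)
  else if p = 2 then 1
  else
    Real.conjExponent p /
      (Real.conjExponent p - 1 +
        (1 + Real.conjExponent p * (Real.conjExponent p - 1) ^ (1 / (Real.conjExponent p - 2))
            + (Real.conjExponent p - 1) ^ (Real.conjExponent p / (Real.conjExponent p - 2))) /
          (1 + (Real.conjExponent p - 1) ^ (1 / (Real.conjExponent p - 2))) ^ Real.conjExponent p)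

/-- The set `I_u` of points where `0 < u < 1`. -/
def interiorSet (u : ℝ → ℝ) : Set ℝ := {ξ | 0 < u ξ ∧ u ξ < 1}

open Classical in
/-- The diffusive flux `D(u) |u'|^(p-2) u'`.  The coefficient `D` need not be defined at `0` and
`1`, and `u'` need not exist where `u` reaches these values; there the flux is given the value
`0`, which is its limit as `u → 0` and `u → 1` for the solutions defined below. -/
def diffFlux (p : ℝ) (D u : ℝ → ℝ) (ξ : ℝ) : ℝ :=
  if ξ ∈ interiorSet u then D (u ξ) * (|deriv u ξ| ^ (p - 2) * deriv u ξ) else 0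

/-- `u` is a solution, with speed `c`, of
`(D(u)|u'|^(p-2)u')' + (c + h(u)) u' + g(u) = 0`, `u(-∞) = 1`, `u(+∞) = 0`. -/
structure IsSolution (p : ℝ) (D h g : ℝ → ℝ) (c : ℝ) (u : ℝ → ℝ) : Prop where
  continuous : Continuous u
  mem_Icc : ∀ ξ, u ξ ∈ Icc (0 : ℝ) 1
  contDiffOn : ContDiffOn ℝ 1 u (interiorSet u)
  flux_differentiableAt : ∀ ξ ∈ interiorSet u, DifferentiableAt ℝ (diffFlux p D u) ξ
  equation : ∀ ξ ∈ interiorSet u,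
    deriv (diffFlux p D u) ξ + (c + h (u ξ)) * deriv u ξ + g (u ξ) = 0
  flux_continuous : Continuous (diffFlux p D u)
  /-- the flux tends to `0` as `u(ξ) → 0` -/
  flux_tendsto_zero : Tendsto (diffFlux p D u) (comap u (𝓝 0)) (𝓝 0)
  /-- the flux tends to `0` as `u(ξ) → 1` -/
  flux_tendsto_one : Tendsto (diffFlux p D u) (comap u (𝓝 1)) (𝓝 0)
  tendsto_atBot : Tendsto u atBot (𝓝 1)
  tendsto_atTop : Tendsto u atTop (𝓝 0)

end

end CombustionWave

open CombustionWave

/-!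
Let `W v` be minus the flux at the point where a decreasing wave of speed `c` takes the value `v`,
and let `f = D ^ (p' - 1) * g`. The equation becomes `W' = c + h - f / W ^ (p' - 1)` with
`W 0 = W 1 = 0`, and `y = W ^ p'` satisfies `y' = p' * ((c + h) * y ^ (1 - 1 / p') - f)`. For every
`c ≥ -h_m` the right-hand side is increasing in `y`, so there is exactly one solution `y ≥ 0` with
`y 1 = 0`, and it depends continuously on `c`. As `f = 0` on `(0, θ]`, the condition `W 0 = 0` says
that `W θ = c * θ + H θ`. At `c = -h_m` the hypothesis makes `W θ` too large, since otherwise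
`p' * ∫ f ≤ (H 1 - h_m) ^ p'`; for large `c` it is too small, since `W θ ^ p' ≤ p' * ∫ f`. So some
`c` fits. It is unique because `W` decreases and `c * θ + H θ` increases with `c`, and the bound on
`W θ ^ p'`, which is strict for `c > -h_m`, is the estimate of the speed.

A wave is recovered from `W` by separating variables. Conversely every wave is decreasing, because
its flux plus `c * u + H u` has derivative `-g u ≤ 0`, so it arises from a profile `W`, which
determines its inverse function up to an additive constant. The constant `k(p)` enters only through
`k(p) < p'`.
-/

namespace CombustionWave

section TerminalValueProblem

/-- `Y` solves the differential equation `Y' = F v Y` on `(α, β)` and is continuous up to the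
endpoints; `F v Y` only has to be meaningful along the solution. -/
structure IsSolOn (F : ℝ → ℝ → ℝ) (α β : ℝ) (Y : ℝ → ℝ) : Prop where
  continuousOn : ContinuousOn Y (Icc α β)
  hasDerivAt : ∀ v ∈ Ioo α β, HasDerivAt Y (F v (Y v)) v

lemma IsSolOn.mono {F : ℝ → ℝ → ℝ} {Y : ℝ → ℝ} {α β α' β' : ℝ} (hY : IsSolOn F α β Y)
    (hα : α ≤ α') (hβ : β' ≤ β) : IsSolOn F α' β' Y where
  continuousOn := hY.continuousOn.mono (Icc_subset_Icc hα hβ)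
  hasDerivAt v hv := hY.hasDerivAt v (Ioo_subset_Ioo hα hβ hv)

lemma exists_first_nonpos {d : ℝ → ℝ} {x β : ℝ} (hxβ : x ≤ β) (hd : ContinuousOn d (Icc x β))
    (hx : 0 < d x) (hβ : d β ≤ 0) : ∃ z ∈ Ioc x β, d z ≤ 0 ∧ ∀ y ∈ Ico x z, 0 < d y := by
  obtain ⟨z, ⟨hz, hdz⟩, hleast⟩ :=
    (isCompact_Icc.of_isClosed_subset (hd.preimage_isClosed_of_isClosed isClosed_Icc isClosed_Iic)
      inter_subset_left).exists_isLeast ⟨β, ⟨hxβ, le_rfl⟩, hβ⟩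
  have hxz : x < z := hz.1.lt_of_ne fun h => hx.not_ge (h ▸ hdz)
  refine ⟨z, ⟨hxz, hz.2⟩, hdz, fun y hy => lt_of_not_ge fun hy0 => ?_⟩
  exact hy.2.not_ge (hleast ⟨⟨hy.1, hy.2.le.trans hz.2⟩, hy0⟩)

/- Between `x` and the first later point where `Y₁ ≤ Y₂`, the mean value theorem applies to
`Y₁ - Y₂`. -/
lemma IsSolOn.sub_le {F₁ F₂ : ℝ → ℝ → ℝ} {Y₁ Y₂ : ℝ → ℝ} {α β η x : ℝ}
    (h₁ : IsSolOn F₁ α β Y₁) (h₂ : IsSolOn F₂ α β Y₂) (hβ : Y₁ β ≤ Y₂ β) (hη : 0 ≤ η)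
    (hF : ∀ v ∈ Ioo α β, Y₂ v < Y₁ v → F₂ v (Y₂ v) - F₁ v (Y₁ v) ≤ η) (hx : x ∈ Icc α β) :
    Y₁ x - Y₂ x ≤ η * (β - x) := by
  rcases le_or_gt (Y₁ x - Y₂ x) 0 with h0 | h0
  · exact h0.trans (mul_nonneg hη (sub_nonneg.2 hx.2))
  have hc : ContinuousOn (fun v => Y₁ v - Y₂ v) (Icc x β) :=
    (h₁.continuousOn.sub h₂.continuousOn).mono (Icc_subset_Icc_left hx.1)
  obtain ⟨z, hz, hdz, hpos⟩ := exists_first_nonpos hx.2 hc h0 (sub_nonpos.2 hβ)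
  have hsub : ∀ v ∈ Ioo x z, v ∈ Ioo α β :=
    fun v hv => ⟨hx.1.trans_lt hv.1, hv.2.trans_le hz.2⟩
  obtain ⟨y, hy, hslope⟩ := exists_hasDerivAt_eq_slope _ _ hz.1
    (hc.mono (Icc_subset_Icc_right hz.2)) fun v hv =>
      (h₁.hasDerivAt v (hsub v hv)).sub (h₂.hasDerivAt v (hsub v hv))
  have hle := hF y (hsub y hy) (sub_pos.1 (hpos y (Ioo_subset_Ico_self hy)))
  rw [eq_div_iff (sub_pos.2 hz.1).ne'] at hslope
  calc Y₁ x - Y₂ x ≤ (F₂ y (Y₂ y) - F₁ y (Y₁ y)) * (z - x) := by linarith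
    _ ≤ η * (β - x) :=
        mul_le_mul hle (by linarith [hz.2]) (sub_pos.2 hz.1).le hη

lemma IsSolOn.le {F₁ F₂ : ℝ → ℝ → ℝ} {Y₁ Y₂ : ℝ → ℝ} {α β x : ℝ}
    (h₁ : IsSolOn F₁ α β Y₁) (h₂ : IsSolOn F₂ α β Y₂) (hβ : Y₁ β ≤ Y₂ β)
    (hF : ∀ v ∈ Ioo α β, Y₂ v < Y₁ v → F₂ v (Y₂ v) ≤ F₁ v (Y₁ v)) (hx : x ∈ Icc α β) :
    Y₁ x ≤ Y₂ x := by
  have h := h₁.sub_le h₂ hβ le_rfl (fun v hv hlt => sub_nonpos.2 (hF v hv hlt)) hx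
  linarith

lemma exists_tendstoUniformlyOn_of_dist_le {α : Type*} {E : Type*} [MetricSpace E]
    [CompleteSpace E] {Y : ℕ → α → E} {s : Set α} {ε : ℕ → ℝ} (hε : Tendsto ε atTop (𝓝 0))
    (hY : ∀ n m, ∀ v ∈ s, dist (Y n v) (Y m v) ≤ ε n + ε m) :
    ∃ Z, TendstoUniformlyOn Y Z atTop s := by
  have hC : UniformCauchySeqOn Y atTop s := by
    refine Metric.uniformCauchySeqOn_iff.2 fun δ hδ => ?_
    obtain ⟨N, hN⟩ := eventually_atTop.1 (hε.eventually (gt_mem_nhds (half_pos hδ)))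
    exact ⟨N, fun m hm n hn v hv => (hY m n v hv).trans_lt (by linarith [hN m hm, hN n hn])⟩
  have hlim : ∀ v, ∃ l, v ∈ s → Tendsto (fun n => Y n v) atTop (𝓝 l) := fun v => by
    by_cases hv : v ∈ s
    · obtain ⟨l, hl⟩ := cauchySeq_tendsto_of_complete (hC.cauchySeq hv)
      exact ⟨l, fun _ => hl⟩
    · exact ⟨Y 0 v, fun h => absurd h hv⟩
  choose Z hZ using hlim
  exact ⟨Z, hC.tendstoUniformlyOn_of_tendsto hZ⟩

lemma IsSolOn.of_tendstoUniformlyOn {Fn : ℕ → ℝ → ℝ → ℝ} {F : ℝ → ℝ → ℝ} {Yn : ℕ → ℝ → ℝ}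
    {Y : ℝ → ℝ} {α β : ℝ} (hYn : ∀ n, IsSolOn (Fn n) α β (Yn n))
    (hY : TendstoUniformlyOn Yn Y atTop (Icc α β))
    (hF : TendstoUniformlyOn (fun n v => Fn n v (Yn n v)) (fun v => F v (Y v)) atTop (Ioo α β)) :
    IsSolOn F α β Y where
  continuousOn := hY.continuousOn (Frequently.of_forall fun n => (hYn n).continuousOn)
  hasDerivAt _ hv := hasDerivAt_of_tendstoUniformlyOn isOpen_Ioo hF
    (Eventually.of_forall fun n => (hYn n).hasDerivAt)
    (fun _ hx => hY.tendsto_at (Ioo_subset_Icc_self hx)) hv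

lemma exists_isSolOn_of_lipschitzWith {b G ρ : ℝ → ℝ} {α β R : ℝ} {k : NNReal} (hαβ : α ≤ β)
    (hb : ContinuousOn b (Icc α β)) (hG : ContinuousOn G (Icc α β)) (hρ : LipschitzWith k ρ)
    (hR : ∀ x, |ρ x| ≤ R) (y : ℝ) :
    ∃ Y, IsSolOn (fun v x => b v * ρ (x - G v)) α β Y ∧ Y β = y := by
  obtain ⟨B, hbB⟩ := isCompact_Icc.exists_bound_of_continuousOn hb
  have hB : 0 ≤ B := (norm_nonneg _).trans (hbB α ⟨le_rfl, hαβ⟩)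
  have hβ : 0 ≤ β - α := sub_nonneg.2 hαβ
  have hR0 : 0 ≤ R := (abs_nonneg _).trans (hR 0)
  have hPL : IsPicardLindelof (fun v x => b v * ρ (x - G v)) (tmin := α) (tmax := β)
      ⟨β, hαβ, le_rfl⟩ y (B * R * (β - α)).toNNReal 0 (B * R).toNNReal (B.toNNReal * k) := by
    refine ⟨fun t ht => LipschitzWith.lipschitzOnWith ?_, fun x _ => ?_, fun t ht x _ => ?_, ?_⟩
    · refine LipschitzWith.of_dist_le_mul fun x y => ?_
      have h := hρ.dist_le_mul (x - G t) (y - G t)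
      rw [dist_sub_right] at h
      rw [Real.dist_eq, ← mul_sub, abs_mul, ← Real.dist_eq, NNReal.coe_mul,
        Real.coe_toNNReal B hB, mul_assoc]
      exact mul_le_mul (hbB t ht) h dist_nonneg hB
    · exact hb.mul (hρ.continuous.comp_continuousOn (continuousOn_const.sub hG))
    · rw [Real.coe_toNNReal _ (mul_nonneg hB hR0), norm_mul]
      exact mul_le_mul (hbB t ht) (hR _) (norm_nonneg _) hB
    · simp [hβ, mul_nonneg hB hR0, mul_nonneg (mul_nonneg hB hR0) hβ]
  obtain ⟨Y, hYβ, hY⟩ := hPL.exists_eq_forall_mem_Icc_hasDerivWithinAt₀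
  exact ⟨Y, ⟨fun v hv => (hY v hv).continuousWithinAt, fun v hv =>
    (hY v (Ioo_subset_Icc_self hv)).hasDerivAt (Icc_mem_nhds hv.1 hv.2)⟩, hYβ⟩

lemma exists_lipschitzWith_near {φ : ℝ → ℝ} {a b ε : ℝ} (hab : a ≤ b)
    (hφ : ContinuousOn φ (Icc a b)) (hε : 0 < ε) :
    ∃ ρ k, LipschitzWith k ρ ∧ ∀ x, |ρ x - φ (projIcc a b hab x)| ≤ ε := by
  obtain ⟨P, hP⟩ := exists_polynomial_near_of_continuousOn a b φ hφ ε hε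
  have hPsmooth : ContDiff ℝ 1 fun x => P.eval x := by simpa using P.contDiff_aeval (𝕜 := ℝ) 1
  obtain ⟨k, hk⟩ := hPsmooth.contDiffOn.exists_lipschitzOnWith one_ne_zero (convex_Icc a b)
    isCompact_Icc
  exact ⟨fun x => P.eval (projIcc a b hab x : ℝ), k * 1,
    hk.to_restrict.comp (LipschitzWith.projIcc hab), fun x => (hP _ (projIcc a b hab x).2).le⟩

lemma uniformContinuous_comp_projIcc {φ : ℝ → ℝ} {a b : ℝ} (hab : a ≤ b)
    (hφ : ContinuousOn φ (Icc a b)) : UniformContinuous fun x => φ (projIcc a b hab x) :=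
  (CompactSpace.uniformContinuous_of_continuous hφ.domRestrict).comp
    (LipschitzWith.projIcc hab).uniformContinuous

lemma tendstoUniformlyOn_mul_of_near {ι : Type*} {b f₀ : ι → ℝ} {f g : ℕ → ι → ℝ} {ε : ℕ → ℝ}
    {B : ℝ} {s : Set ι} (hb : ∀ v ∈ s, |b v| ≤ B) (hε : Tendsto ε atTop (𝓝 0))
    (hfg : ∀ n, ∀ v ∈ s, |g n v - f n v| ≤ ε n) (hf : TendstoUniformlyOn f f₀ atTop s) :
    TendstoUniformlyOn (fun n v => b v * g n v) (fun v => b v * f₀ v) atTop s := by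
  rw [Metric.tendstoUniformlyOn_iff] at hf ⊢
  intro δ hδ
  have hδB : 0 < δ / (2 * (|B| + 1)) := by positivity
  filter_upwards [hf _ hδB, hε.eventually (gt_mem_nhds hδB)] with n hn hεn v hv
  have hnear : |f₀ v - g n v| ≤ 2 * (δ / (2 * (|B| + 1))) := by
    have h := hn v hv
    rw [Real.dist_eq] at h
    linarith [abs_sub_le (f₀ v) (f n v) (g n v), abs_sub_comm (f n v) (g n v), hfg n v hv]
  calc dist (b v * f₀ v) (b v * g n v) = |b v| * |f₀ v - g n v| := by
        rw [Real.dist_eq, ← mul_sub, abs_mul]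
    _ ≤ |B| * (2 * (δ / (2 * (|B| + 1)))) :=
        mul_le_mul ((hb v hv).trans (le_abs_self B)) hnear (abs_nonneg _) (abs_nonneg _)
    _ < (|B| + 1) * (2 * (δ / (2 * (|B| + 1)))) := by gcongr; exact lt_add_one _
    _ = δ := by field_simp

/- Monotonicity of `ψ` makes solutions of the nearby equations with the same terminal value close
to each other, so they converge although `ψ` need not be Lipschitz. -/
lemma exists_isSolOn_of_approx {b G ψ : ℝ → ℝ} {ρ Yn : ℕ → ℝ → ℝ} {ε : ℕ → ℝ} {α β y : ℝ}
    (hαβ : α ≤ β) (hb : ContinuousOn b (Icc α β)) (hb0 : ∀ v ∈ Icc α β, 0 ≤ b v)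
    (hψ : Monotone ψ) (hψc : UniformContinuous ψ) (hε : Tendsto ε atTop (𝓝 0))
    (hρ : ∀ n x, |ρ n x - ψ x| ≤ ε n)
    (hYn : ∀ n, IsSolOn (fun v x => b v * ρ n (x - G v)) α β (Yn n)) (hy : ∀ n, Yn n β = y) :
    ∃ Y, IsSolOn (fun v x => b v * ψ (x - G v)) α β Y ∧ Y β = y := by
  obtain ⟨B, hbB⟩ := isCompact_Icc.exists_bound_of_continuousOn hb
  have hB : 0 ≤ B := (norm_nonneg _).trans (hbB α ⟨le_rfl, hαβ⟩)
  have hε0 : ∀ n, 0 ≤ ε n := fun n => (abs_nonneg _).trans (hρ n 0)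
  have hsub : ∀ n m, ∀ v ∈ Icc α β, Yn n v - Yn m v ≤ B * ε n * (β - α) + B * ε m * (β - α) := by
    intro n m v hv
    have hη : 0 ≤ B * (ε n + ε m) := mul_nonneg hB (add_nonneg (hε0 n) (hε0 m))
    refine ((hYn n).sub_le (hYn m) ((hy n).trans (hy m).symm).le hη (fun x hx hlt => ?_) hv).trans
      ((mul_le_mul_of_nonneg_left (sub_le_sub_left hv.1 β) hη).trans_eq (by ring))
    have hx' := Ioo_subset_Icc_self hx
    rw [← mul_sub]
    refine mul_le_mul_of_nonneg ((le_abs_self _).trans (hbB x hx')) ?_ (hb0 x hx')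
      (add_nonneg (hε0 n) (hε0 m))
    have hmono := hψ (sub_le_sub_right hlt.le (G x))
    linarith [(abs_le.1 (hρ m (Yn m x - G x))).2, (abs_le.1 (hρ n (Yn n x - G x))).1]
  obtain ⟨Y, hY⟩ := exists_tendstoUniformlyOn_of_dist_le (Y := Yn) (s := Icc α β)
    (ε := fun n => B * ε n * (β - α)) (by simpa using (hε.const_mul B).mul_const (β - α))
    fun n m v hv => abs_sub_le_iff.2 ⟨hsub n m v hv, (hsub m n v hv).trans_eq (add_comm _ _)⟩
  have hsol : TendstoUniformlyOn (fun n v => b v * ρ n (Yn n v - G v))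
      (fun v => b v * ψ (Y v - G v)) atTop (Icc α β) := by
    refine tendstoUniformlyOn_mul_of_near hbB hε (fun n v _ => hρ n _)
      (hψc.comp_tendstoUniformlyOn ?_)
    simpa only [Metric.tendstoUniformlyOn_iff, dist_sub_right] using
      Metric.tendstoUniformlyOn_iff.1 hY
  exact ⟨Y, .of_tendstoUniformlyOn hYn hY (hsol.mono Ioo_subset_Icc_self),
    tendsto_nhds_unique (hY.tendsto_at ⟨hαβ, le_rfl⟩) (by simp [hy])⟩

lemma exists_isSolOn_comp_projIcc {b G φ : ℝ → ℝ} {α β l r : ℝ} (hαβ : α ≤ β) (hlr : l ≤ r)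
    (hb : ContinuousOn b (Icc α β)) (hb0 : ∀ v ∈ Icc α β, 0 ≤ b v)
    (hG : ContinuousOn G (Icc α β)) (hφ : ContinuousOn φ (Icc l r))
    (hmono : MonotoneOn φ (Icc l r)) (y : ℝ) :
    ∃ Y, IsSolOn (fun v x => b v * φ (projIcc l r hlr (x - G v))) α β Y ∧ Y β = y := by
  have hψ : Monotone fun x => φ (projIcc l r hlr x) := fun x x' hx =>
    hmono (projIcc l r hlr x).2 (projIcc l r hlr x').2 (monotone_projIcc hlr hx)
  choose ρ k hρ hnear using fun n : ℕ =>
    exists_lipschitzWith_near hlr hφ (Nat.one_div_pos_of_nat (α := ℝ) (n := n))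
  obtain ⟨R, hR⟩ := isCompact_Icc.exists_bound_of_continuousOn hφ
  have hρR : ∀ n x, |ρ n x| ≤ R + 1 / ((n : ℝ) + 1) := fun n x => by
    have h := hR _ (projIcc l r hlr x).2
    rw [Real.norm_eq_abs] at h
    linarith [abs_sub_abs_le_abs_sub (ρ n x) (φ (projIcc l r hlr x)), hnear n x]
  choose Yn hYn hy using fun n => exists_isSolOn_of_lipschitzWith hαβ hb hG (hρ n) (hρR n) y
  exact exists_isSolOn_of_approx hαβ hb hb0 hψ (uniformContinuous_comp_projIcc hlr hφ)
    tendsto_one_div_add_atTop_nhds_zero_nat hnear hYn hy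

end TerminalValueProblem

section Reaction

/-- A reaction term of combustion type with ignition threshold `θ`: it vanishes up to `θ` and is
positive beyond. Both `g` and the weighted reaction `D ^ (p' - 1) * g` are of this kind; nothing is
asked at the endpoints `0` and `1`, where the latter may be singular. -/
structure IsReaction (θ : ℝ) (f : ℝ → ℝ) : Prop where
  mem : θ ∈ Ioo (0 : ℝ) 1
  continuousOn : ContinuousOn f (Ioo 0 1)
  zero : ∀ v ∈ Ioc 0 θ, f v = 0
  pos : ∀ v ∈ Ioo θ 1, 0 < f v

variable {f : ℝ → ℝ} {θ a b v : ℝ}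

lemma hasDerivAt_integral_of_continuousOn_Ioo (hf : ContinuousOn f (Ioo a b))
    (hfi : IntervalIntegrable f volume a b) (hv : v ∈ Ioo a b) :
    HasDerivAt (fun v => ∫ t in a..v, f t) (f v) v :=
  intervalIntegral.integral_hasDerivAt_right
    (hfi.mono_set (uIcc_subset_uIcc_left (Icc_subset_uIcc (Ioo_subset_Icc_self hv))))
    (hf.stronglyMeasurableAtFilter isOpen_Ioo v hv) (hf.continuousAt (Ioo_mem_nhds hv.1 hv.2))

lemma continuousOn_integral_Icc (hab : a ≤ b) (hfi : IntervalIntegrable f volume a b) :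
    ContinuousOn (fun v => ∫ t in a..v, f t) (Icc a b) := by
  simpa only [uIcc_of_le hab] using
    intervalIntegral.continuousOn_primitive_interval' hfi left_mem_uIcc

namespace IsReaction

lemma nonneg (hf : IsReaction θ f) (hv : v ∈ Ioo (0 : ℝ) 1) : 0 ≤ f v := by
  rcases le_or_gt v θ with h | h
  · exact (hf.zero v ⟨hv.1, h⟩).ge
  · exact (hf.pos v ⟨h, hv.2⟩).le

lemma Ioo_subset (hf : IsReaction θ f) : Ioo θ 1 ⊆ Ioo 0 1 := Ioo_subset_Ioo_left hf.mem.1.le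

lemma Icc_subset (hf : IsReaction θ f) : Icc θ 1 ⊆ Icc 0 1 := Icc_subset_Icc_left hf.mem.1.le

lemma integral_nonneg (hf : IsReaction θ f) (hv : v ∈ Icc (0 : ℝ) 1) :
    0 ≤ ∫ t in (0 : ℝ)..v, f t := by
  rw [intervalIntegral.integral_of_le hv.1, integral_Ioc_eq_integral_Ioo]
  exact setIntegral_nonneg measurableSet_Ioo fun t ht => hf.nonneg ⟨ht.1, ht.2.trans_le hv.2⟩

lemma integral_threshold (hf : IsReaction θ f) : ∫ t in (0 : ℝ)..θ, f t = 0 := by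
  rw [intervalIntegral.integral_of_le hf.mem.1.le]
  exact setIntegral_eq_zero_of_forall_eq_zero hf.zero

lemma integral_pos (hf : IsReaction θ f) (hfi : IntervalIntegrable f volume 0 1) :
    0 < ∫ t in (0 : ℝ)..1, f t := by
  have hθ : θ ∈ uIcc (0 : ℝ) 1 := Icc_subset_uIcc (Ioo_subset_Icc_self hf.mem)
  have hθ1 : IntervalIntegrable f volume θ 1 := hfi.mono_set (uIcc_subset_uIcc_right hθ)
  rw [← intervalIntegral.integral_add_adjacent_intervals
    (hfi.mono_set (uIcc_subset_uIcc_left hθ)) hθ1, hf.integral_threshold, zero_add]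
  exact intervalIntegral.intervalIntegral_pos_of_pos_on hθ1 hf.pos hf.mem.2

end IsReaction

end Reaction

section DriftPrimitive

/-- The primitive `c v + H(v)` of the drift `c + h` which vanishes at `0`. -/
noncomputable def driftPrimitive (h : ℝ → ℝ) (c v : ℝ) : ℝ := c * v + fluxH h v

variable {h : ℝ → ℝ} {c v : ℝ}

lemma hMin_le (hh : ContinuousOn h (Icc 0 1)) (hv : v ∈ Icc (0 : ℝ) 1) : hMin h ≤ h v :=
  csInf_le (isCompact_Icc.image_of_continuousOn hh).bddBelow (mem_image_of_mem h hv)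

lemma drift_nonneg (hh : ContinuousOn h (Icc 0 1)) (hc : -hMin h ≤ c) (hv : v ∈ Icc (0 : ℝ) 1) :
    0 ≤ c + h v := by
  linarith [hMin_le hh hv]

lemma drift_pos (hh : ContinuousOn h (Icc 0 1)) (hc : -hMin h < c) (hv : v ∈ Icc (0 : ℝ) 1) :
    0 < c + h v := by
  linarith [hMin_le hh hv]

@[simp] lemma driftPrimitive_zero : driftPrimitive h c 0 = 0 := by
  simp [driftPrimitive, fluxH]

lemma hasDerivAt_driftPrimitive (hh : ContinuousOn h (Icc 0 1)) (hv : v ∈ Ioo (0 : ℝ) 1) :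
    HasDerivAt (driftPrimitive h c) (c + h v) v :=
  (((hasDerivAt_id v).const_mul c).add (hasDerivAt_integral_of_continuousOn_Ioo
    (hh.mono Ioo_subset_Icc_self) (hh.intervalIntegrable_of_Icc zero_le_one) hv)).congr_deriv
    (by simp)

lemma continuousOn_driftPrimitive (hh : ContinuousOn h (Icc 0 1)) :
    ContinuousOn (driftPrimitive h c) (Icc 0 1) :=
  (continuous_const.mul continuous_id).continuousOn.add
    (continuousOn_integral_Icc zero_le_one (hh.intervalIntegrable_of_Icc zero_le_one))

lemma monotoneOn_driftPrimitive (hh : ContinuousOn h (Icc 0 1)) (hc : -hMin h ≤ c) :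
    MonotoneOn (driftPrimitive h c) (Icc 0 1) := by
  refine monotoneOn_of_hasDerivWithinAt_nonneg (f' := fun v => c + h v) (convex_Icc 0 1)
    (continuousOn_driftPrimitive hh) ?_ ?_ <;> rw [interior_Icc]
  · exact fun v hv => (hasDerivAt_driftPrimitive hh hv).hasDerivWithinAt
  · exact fun v hv => drift_nonneg hh hc (Ioo_subset_Icc_self hv)

lemma strictMonoOn_driftPrimitive (hh : ContinuousOn h (Icc 0 1)) (hc : -hMin h < c) :
    StrictMonoOn (driftPrimitive h c) (Icc 0 1) := by
  refine strictMonoOn_of_hasDerivWithinAt_pos (f' := fun v => c + h v) (convex_Icc 0 1)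
    (continuousOn_driftPrimitive hh) ?_ ?_ <;> rw [interior_Icc]
  · exact fun v hv => (hasDerivAt_driftPrimitive hh hv).hasDerivWithinAt
  · exact fun v hv => drift_pos hh hc (Ioo_subset_Icc_self hv)

lemma driftPrimitive_nonneg (hh : ContinuousOn h (Icc 0 1)) (hc : -hMin h ≤ c)
    (hv : v ∈ Icc (0 : ℝ) 1) : 0 ≤ driftPrimitive h c v := by
  simpa using monotoneOn_driftPrimitive hh hc (left_mem_Icc.2 zero_le_one) hv hv.1

lemma driftPrimitive_pos (hh : ContinuousOn h (Icc 0 1)) (hc : -hMin h < c)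
    (hv : v ∈ Ioc (0 : ℝ) 1) : 0 < driftPrimitive h c v := by
  simpa using strictMonoOn_driftPrimitive hh hc (left_mem_Icc.2 zero_le_one)
    (Ioc_subset_Icc_self hv) hv.1

end DriftPrimitive

section PhasePlane

variable {q θ c α β : ℝ} {h f y : ℝ → ℝ}

/-- The right-hand side of the phase plane equation `y' = q ((c + h) y ^ (1 - 1/q) - f)`. With
`q = p'` and `f = D ^ (p' - 1) * g` it is satisfied by `y = W ^ q` when `W v` is minus the flux of
a decreasing wave of speed `c` at the point where the wave takes the value `v`. -/
noncomputable def phaseField (q : ℝ) (h f : ℝ → ℝ) (c v y : ℝ) : ℝ :=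
  q * ((c + h v) * y ^ ((q - 1) / q) - f v)

/-- A nonnegative solution of the phase plane equation of speed `c` on `[α, β]`. -/
structure IsPhaseSol (q : ℝ) (h f : ℝ → ℝ) (c α β : ℝ) (y : ℝ → ℝ) : Prop
    extends IsSolOn (phaseField q h f c) α β y where
  nonneg : ∀ v ∈ Icc α β, 0 ≤ y v

lemma isSolOn_mul_integral (hf : IsReaction θ f) (hfi : IntervalIntegrable f volume 0 1) :
    IsSolOn (fun v _ => q * f v) 0 1 fun v => q * ∫ t in (0 : ℝ)..v, f t where
  continuousOn := (continuousOn_integral_Icc zero_le_one hfi).const_mul q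
  hasDerivAt _ hv :=
    (hasDerivAt_integral_of_continuousOn_Ioo hf.continuousOn hfi hv).const_mul q

/- In terms of `Y = y + q ∫ f` the equation is `Y' = q (c + h) (Y - q ∫ f) ^ (1 - 1/q)`, which
has a solution once the base of the power is clamped to `[0, q ∫ f]`; comparison with
`q ∫ f` and with its terminal value shows that the clamp is inactive. -/
lemma exists_isPhaseSol (hq : 1 < q) (hh : ContinuousOn h (Icc 0 1)) (hf : IsReaction θ f)
    (hfi : IntervalIntegrable f volume 0 1) (hc : -hMin h ≤ c) :
    ∃ y, IsPhaseSol q h f c 0 1 y ∧ y 1 = 0 := by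
  have hq0 : 0 < q := zero_lt_one.trans hq
  have hr : 0 < (q - 1) / q := div_pos (sub_pos.2 hq) hq0
  set G : ℝ → ℝ := fun v => q * ∫ t in (0 : ℝ)..v, f t
  have hG : IsSolOn (fun v _ => q * f v) 0 1 G := isSolOn_mul_integral hf hfi
  have hG0 : ∀ v ∈ Icc (0 : ℝ) 1, 0 ≤ G v := fun v hv => mul_nonneg hq0.le (hf.integral_nonneg hv)
  have hM : 0 ≤ G 1 := hG0 1 (right_mem_Icc.2 zero_le_one)
  have hb : ∀ v ∈ Icc (0 : ℝ) 1, 0 ≤ q * (c + h v) :=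
    fun v hv => mul_nonneg hq0.le (drift_nonneg hh hc hv)
  obtain ⟨Y, hY, hY1⟩ := exists_isSolOn_comp_projIcc (φ := fun x => x ^ ((q - 1) / q))
    zero_le_one hM ((hh.const_add c).const_mul q) hb hG.continuousOn
    (Real.continuous_rpow_const hr.le).continuousOn
    (fun x hx x' _ hxx' => Real.rpow_le_rpow hx.1 hxx' hr.le) (G 1)
  have hGY : ∀ v ∈ Icc (0 : ℝ) 1, G v ≤ Y v := fun v => hG.le hY hY1.ge fun x hx hlt => by
    rw [projIcc_of_le_left hM (sub_nonpos.2 hlt.le), Real.zero_rpow hr.ne', mul_zero]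
    exact mul_nonneg hq0.le (hf.nonneg hx)
  have hYM : ∀ v ∈ Icc (0 : ℝ) 1, Y v ≤ G 1 := fun v =>
    hY.le (F₂ := fun _ _ => 0) (Y₂ := fun _ => G 1)
      ⟨continuousOn_const, fun x _ => hasDerivAt_const x _⟩ hY1.le fun x hx _ =>
        mul_nonneg (hb x (Ioo_subset_Icc_self hx)) (Real.rpow_nonneg (projIcc 0 _ hM _).2.1 _)
  refine ⟨fun v => Y v - G v, ⟨⟨hY.continuousOn.sub hG.continuousOn, fun v hv => ?_⟩,
    fun v hv => sub_nonneg.2 (hGY v hv)⟩, sub_eq_zero.2 hY1⟩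
  have hv' := Ioo_subset_Icc_self hv
  refine ((hY.hasDerivAt v hv).sub (hG.hasDerivAt v hv)).congr_deriv ?_
  rw [projIcc_of_mem hM ⟨sub_nonneg.2 (hGY v hv'), by linarith [hYM v hv', hG0 v hv']⟩]
  simp only [phaseField]
  ring

namespace IsPhaseSol

lemma sub_le {c₁ c₂ η v : ℝ} {y₁ y₂ : ℝ → ℝ} (h₁ : IsPhaseSol q h f c₁ α β y₁)
    (h₂ : IsPhaseSol q h f c₂ α β y₂) (hq : 1 < q) (hβ : y₁ β ≤ y₂ β) (hη : 0 ≤ η)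
    (hdrift : ∀ v ∈ Ioo α β, 0 ≤ c₁ + h v)
    (hc : ∀ v ∈ Ioo α β, q * ((c₂ - c₁) * y₂ v ^ ((q - 1) / q)) ≤ η) (hv : v ∈ Icc α β) :
    y₁ v - y₂ v ≤ η * (β - v) := by
  refine h₁.toIsSolOn.sub_le h₂.toIsSolOn hβ hη (fun x hx hlt => ?_) hv
  have hr : 0 ≤ (q - 1) / q := div_nonneg (sub_nonneg.2 hq.le) (by linarith)
  have hpow : y₂ x ^ ((q - 1) / q) ≤ y₁ x ^ ((q - 1) / q) :=
    Real.rpow_le_rpow (h₂.nonneg x (Ioo_subset_Icc_self hx)) hlt.le hr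
  have hmono := mul_le_mul_of_nonneg_left (mul_le_mul_of_nonneg_left hpow (hdrift x hx))
    (by linarith : 0 ≤ q)
  simp only [phaseField]
  linarith [hc x hx]

lemma le_of_terminal_le {v : ℝ} {y₁ y₂ : ℝ → ℝ} (h₁ : IsPhaseSol q h f c α β y₁)
    (h₂ : IsPhaseSol q h f c α β y₂) (hq : 1 < q) (hβ : y₁ β ≤ y₂ β)
    (hdrift : ∀ v ∈ Ioo α β, 0 ≤ c + h v) (hv : v ∈ Icc α β) : y₁ v ≤ y₂ v := by
  have h := h₁.sub_le h₂ hq hβ le_rfl hdrift (fun x _ => by simp) hv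
  linarith

lemma phaseField_add_nonneg (hy : IsPhaseSol q h f c 0 1 y) (hq : 1 < q)
    (hh : ContinuousOn h (Icc 0 1)) (hc : -hMin h ≤ c) {v : ℝ} (hv : v ∈ Icc (0 : ℝ) 1) :
    0 ≤ phaseField q h f c v (y v) + q * f v := by
  have h := mul_nonneg (zero_lt_one.trans hq).le (mul_nonneg (drift_nonneg hh hc hv)
    (Real.rpow_nonneg (hy.nonneg v hv) ((q - 1) / q)))
  simp only [phaseField]
  linarith

lemma le_integral (hy : IsPhaseSol q h f c 0 1 y) (hy1 : y 1 = 0) (hq : 1 < q)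
    (hh : ContinuousOn h (Icc 0 1)) (hf : IsReaction θ f)
    (hfi : IntervalIntegrable f volume 0 1) (hc : -hMin h ≤ c) {v : ℝ} (hv : v ∈ Icc (0 : ℝ) 1) :
    y v ≤ q * ∫ t in (0 : ℝ)..1, f t := by
  have hG := isSolOn_mul_integral (q := q) hf hfi
  have hle := hy.toIsSolOn.le (F₂ := fun v _ => -(q * f v))
    (Y₂ := fun v => (q * ∫ t in (0 : ℝ)..1, f t) - q * ∫ t in (0 : ℝ)..v, f t)
    ⟨continuousOn_const.sub hG.continuousOn, fun x hx => (hG.hasDerivAt x hx).const_sub _⟩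
    (by simp [hy1])
    (fun x hx _ => by linarith [hy.phaseField_add_nonneg hq hh hc (Ioo_subset_Icc_self hx)]) hv
  linarith [mul_nonneg (zero_lt_one.trans hq).le (hf.integral_nonneg hv)]

end IsPhaseSol

/- Solutions with zero terminal value are bounded by `M = q ∫ f` whatever the speed, so they are
Lipschitz in the speed with constant `q M ^ (1 - 1/q)`. -/
lemma continuousOn_isPhaseSol_speed {y : ℝ → ℝ → ℝ} (hq : 1 < q) (hh : ContinuousOn h (Icc 0 1))
    (hf : IsReaction θ f) (hfi : IntervalIntegrable f volume 0 1)
    (hy : ∀ c, -hMin h ≤ c → IsPhaseSol q h f c 0 1 (y c) ∧ y c 1 = 0) {v : ℝ}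
    (hv : v ∈ Icc (0 : ℝ) 1) : ContinuousOn (fun c => y c v) (Ici (-hMin h)) := by
  have hq0 : 0 < q := zero_lt_one.trans hq
  set M : ℝ := q * ∫ t in (0 : ℝ)..1, f t
  have hM : 0 ≤ M := mul_nonneg hq0.le (hf.integral_nonneg (right_mem_Icc.2 zero_le_one))
  set L : ℝ := q * M ^ ((q - 1) / q)
  have hL : 0 ≤ L := mul_nonneg hq0.le (Real.rpow_nonneg hM _)
  have hsub : ∀ c₁ ∈ Ici (-hMin h), ∀ c₂ ∈ Ici (-hMin h), y c₁ v - y c₂ v ≤ L * |c₁ - c₂| := by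
    intro c₁ h₁ c₂ h₂
    have hη : 0 ≤ L * |c₁ - c₂| := mul_nonneg hL (abs_nonneg _)
    refine ((hy c₁ h₁).1.sub_le (hy c₂ h₂).1 hq ((hy c₁ h₁).2.trans (hy c₂ h₂).2.symm).le hη
      (fun x hx => drift_nonneg hh h₁ (Ioo_subset_Icc_self hx)) (fun x hx => ?_) hv).trans
      (mul_le_of_le_one_right hη (by linarith [hv.1]))
    have hx' := Ioo_subset_Icc_self hx
    have hpow : y c₂ x ^ ((q - 1) / q) ≤ M ^ ((q - 1) / q) :=
      Real.rpow_le_rpow ((hy c₂ h₂).1.nonneg x hx')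
        ((hy c₂ h₂).1.le_integral (hy c₂ h₂).2 hq hh hf hfi h₂ hx')
        (div_nonneg (sub_nonneg.2 hq.le) hq0.le)
    calc q * ((c₂ - c₁) * y c₂ x ^ ((q - 1) / q))
        ≤ q * (|c₁ - c₂| * M ^ ((q - 1) / q)) := by
          refine mul_le_mul_of_nonneg_left (mul_le_mul ?_ hpow
            (Real.rpow_nonneg ((hy c₂ h₂).1.nonneg x hx') _) (abs_nonneg _)) hq0.le
          rw [abs_sub_comm]
          exact le_abs_self _
      _ = L * |c₁ - c₂| := by ring
  refine LipschitzOnWith.continuousOn (K := ⟨L, hL⟩)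
    (LipschitzOnWith.of_dist_le_mul fun c₁ h₁ c₂ h₂ => ?_)
  exact abs_sub_le_iff.2 ⟨hsub c₁ h₁ c₂ h₂, dist_comm c₁ c₂ ▸ hsub c₂ h₂ c₁ h₁⟩

end PhasePlane

lemma eq_of_hasDerivAt_zero {f : ℝ → ℝ} {a b : ℝ} (hab : a ≤ b) (hf : ContinuousOn f (Icc a b))
    (hd : ∀ x ∈ Ioo a b, HasDerivAt f 0 x) : f a = f b := by
  rcases hab.eq_or_lt with rfl | hlt
  · rfl
  obtain ⟨x, -, hslope⟩ := exists_hasDerivAt_eq_slope f (fun _ => 0) hlt hf hd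
  rw [eq_div_iff (sub_pos.2 hlt).ne', zero_mul] at hslope
  exact (sub_eq_zero.1 hslope.symm).symm

section Shooting

variable {q θ c α β v : ℝ} {h f y : ℝ → ℝ}

/-- The right-hand side of the equation `W' = c + h - f / W ^ (q - 1)` satisfied by the flux of a
wave as a function of the density; it is the phase plane equation after `y = W ^ q`. -/
noncomputable def fluxField (q : ℝ) (h f : ℝ → ℝ) (c v w : ℝ) : ℝ := c + h v - f v / w ^ (q - 1)

lemma isPhaseSol_driftPrimitive_rpow (hq : 1 < q) (hh : ContinuousOn h (Icc 0 1))
    (hf : IsReaction θ f) (hc : -hMin h ≤ c) :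
    IsPhaseSol q h f c 0 θ fun v => driftPrimitive h c v ^ q where
  continuousOn := ((continuousOn_driftPrimitive hh).rpow_const fun _ _ => Or.inr (by linarith)).mono
    (Icc_subset_Icc_right hf.mem.2.le)
  hasDerivAt v hv := by
    have hv1 : v ∈ Ioo (0 : ℝ) 1 := ⟨hv.1, hv.2.trans hf.mem.2⟩
    have hK := driftPrimitive_nonneg hh hc (Ioo_subset_Icc_self hv1)
    refine ((hasDerivAt_driftPrimitive hh hv1).rpow_const (Or.inr hq.le)).congr_deriv ?_
    rw [phaseField, hf.zero v ⟨hv.1, hv.2.le⟩, ← Real.rpow_mul hK,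
      mul_div_cancel₀ (q - 1) (by linarith : q ≠ 0)]
    ring
  nonneg v hv := Real.rpow_nonneg (driftPrimitive_nonneg hh hc ⟨hv.1, hv.2.trans hf.mem.2.le⟩) q

namespace IsPhaseSol

lemma eq_driftPrimitive_rpow (hy : IsPhaseSol q h f c 0 1 y) (hq : 1 < q)
    (hh : ContinuousOn h (Icc 0 1)) (hf : IsReaction θ f) (hc : -hMin h ≤ c)
    (hθ : y θ = driftPrimitive h c θ ^ q) (hv : v ∈ Icc 0 θ) : y v = driftPrimitive h c v ^ q := by
  have hyθ : IsPhaseSol q h f c 0 θ y :=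
    ⟨hy.toIsSolOn.mono le_rfl hf.mem.2.le, fun x hx => hy.nonneg x ⟨hx.1, hx.2.trans hf.mem.2.le⟩⟩
  have hK := isPhaseSol_driftPrimitive_rpow hq hh hf hc
  have hdrift : ∀ x ∈ Ioo 0 θ, 0 ≤ c + h x :=
    fun x hx => drift_nonneg hh hc ⟨hx.1.le, hx.2.le.trans hf.mem.2.le⟩
  exact le_antisymm (hyθ.le_of_terminal_le hK hq hθ.le hdrift hv)
    (hK.le_of_terminal_le hyθ hq hθ.ge hdrift hv)

/- A zero of `y` is a minimum, but there the derivative is `-q f < 0`. -/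
lemma pos (hy : IsPhaseSol q h f c 0 1 y) (hq : 1 < q) (hf : IsReaction θ f) (hv : v ∈ Ioo θ 1) :
    0 < y v := by
  have hv1 := hf.Ioo_subset hv
  refine (hy.nonneg v (Ioo_subset_Icc_self hv1)).lt_of_ne fun h0 => ?_
  have hmin : IsLocalMin y v := by
    filter_upwards [Icc_mem_nhds hv1.1 hv1.2] with x hx
    exact h0 ▸ hy.nonneg x hx
  have hzero := hmin.hasDerivAt_eq_zero (hy.hasDerivAt v hv1)
  rw [phaseField, ← h0, Real.zero_rpow (div_pos (sub_pos.2 hq) (by linarith)).ne'] at hzero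
  linarith [mul_pos (by linarith : 0 < q) (hf.pos v hv)]

lemma lt_integral (hy : IsPhaseSol q h f c 0 1 y) (hy1 : y 1 = 0) (hq : 1 < q)
    (hh : ContinuousOn h (Icc 0 1)) (hf : IsReaction θ f)
    (hfi : IntervalIntegrable f volume 0 1) (hc : -hMin h < c) :
    y θ < q * ∫ t in (0 : ℝ)..1, f t := by
  have hG := isSolOn_mul_integral (q := q) hf hfi
  have hmono : StrictMonoOn (fun v => y v + q * ∫ t in (0 : ℝ)..v, f t) (Icc θ 1) := by
    refine strictMonoOn_of_hasDerivWithinAt_pos (convex_Icc θ 1)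
      ((hy.continuousOn.add hG.continuousOn).mono hf.Icc_subset)
      (f' := fun v => phaseField q h f c v (y v) + q * f v) ?_ ?_ <;> rw [interior_Icc]
    · exact fun v hv => ((hy.hasDerivAt v (hf.Ioo_subset hv)).add
        (hG.hasDerivAt v (hf.Ioo_subset hv))).hasDerivWithinAt
    · intro v hv
      have hpos := mul_pos (zero_lt_one.trans hq) (mul_pos
        (drift_pos hh hc (Ioo_subset_Icc_self (hf.Ioo_subset hv)))
        (Real.rpow_pos_of_pos (hy.pos hq hf hv) ((q - 1) / q)))
      simp only [phaseField]
      linarith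
  simpa [hy1, hf.integral_threshold] using
    hmono (left_mem_Icc.2 hf.mem.2.le) (right_mem_Icc.2 hf.mem.2.le) hf.mem.2

lemma isSolOn_root (hy : IsPhaseSol q h f c α β y) (hq : 1 < q) (hpos : ∀ v ∈ Ioo α β, 0 < y v) :
    IsSolOn (fluxField q h f c) α β fun v => y v ^ (1 / q) where
  continuousOn := hy.continuousOn.rpow_const fun _ _ => Or.inr (by positivity)
  hasDerivAt v hv := by
    have hyv := hpos v hv
    have hq0 : q ≠ 0 := by linarith
    refine ((hy.hasDerivAt v hv).rpow_const (Or.inl hyv.ne')).congr_deriv ?_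
    have hinv : y v ^ (1 / q - 1) = (y v ^ ((q - 1) / q))⁻¹ := by
      rw [← Real.rpow_neg hyv.le]
      congr 1
      field_simp
      ring
    have hne : y v ^ ((q - 1) / q) ≠ 0 := (Real.rpow_pos_of_pos hyv _).ne'
    rw [fluxField, phaseField, hinv, ← Real.rpow_mul hyv.le, one_div_mul_eq_div]
    field_simp

lemma root_le_driftPrimitive (hy : IsPhaseSol q h f c 0 1 y) (hq : 1 < q)
    (hh : ContinuousOn h (Icc 0 1)) (hf : IsReaction θ f) (hc : -hMin h ≤ c)
    (hθ : y θ ≤ driftPrimitive h c θ ^ q) (hv : v ∈ Icc θ 1) :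
    y v ^ (1 / q) ≤ driftPrimitive h c v := by
  have hθ1 : θ ∈ Icc (0 : ℝ) 1 := Ioo_subset_Icc_self hf.mem
  have hW : IsSolOn (fluxField q h f c) θ 1 fun v => y v ^ (1 / q) :=
    isSolOn_root ⟨hy.toIsSolOn.mono hf.mem.1.le le_rfl, fun x hx => hy.nonneg x (hf.Icc_subset hx)⟩
      hq fun x hx => hy.pos hq hf hx
  have hanti : AntitoneOn (fun v => y v ^ (1 / q) - driftPrimitive h c v) (Icc θ 1) := by
    refine antitoneOn_of_hasDerivWithinAt_nonpos (convex_Icc θ 1)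
      (hW.continuousOn.sub ((continuousOn_driftPrimitive hh).mono hf.Icc_subset))
      (f' := fun v => fluxField q h f c v (y v ^ (1 / q)) - (c + h v)) ?_ ?_ <;> rw [interior_Icc]
    · exact fun v hv => ((hW.hasDerivAt v hv).sub
        (hasDerivAt_driftPrimitive hh (hf.Ioo_subset hv))).hasDerivWithinAt
    · intro v hv
      have hdiv : 0 ≤ f v / (y v ^ (1 / q)) ^ (q - 1) := div_nonneg (hf.pos v hv).le
        (Real.rpow_nonneg (Real.rpow_nonneg (hy.pos hq hf hv).le _) _)
      simp only [fluxField]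
      linarith
  have hroot : y θ ^ (1 / q) ≤ driftPrimitive h c θ := by
    rw [one_div]
    exact (Real.rpow_inv_le_iff_of_pos (hy.nonneg θ hθ1) (driftPrimitive_nonneg hh hc hθ1)
      (by linarith)).2 hθ
  exact sub_nonpos.1 ((hanti (left_mem_Icc.2 hf.mem.2.le) hv hv.1).trans (sub_nonpos.2 hroot))

lemma integral_le_driftPrimitive_rpow (hy : IsPhaseSol q h f c 0 1 y) (hy1 : y 1 = 0) (hq : 1 < q)
    (hh : ContinuousOn h (Icc 0 1)) (hf : IsReaction θ f)
    (hfi : IntervalIntegrable f volume 0 1) (hc : -hMin h ≤ c)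
    (hθ : y θ ≤ driftPrimitive h c θ ^ q) :
    q * ∫ t in (0 : ℝ)..1, f t ≤ driftPrimitive h c 1 ^ q := by
  have hG := isSolOn_mul_integral (q := q) hf hfi
  have hanti : AntitoneOn (fun v => y v - driftPrimitive h c v ^ q + q * ∫ t in (0 : ℝ)..v, f t)
      (Icc θ 1) := by
    refine antitoneOn_of_hasDerivWithinAt_nonpos (convex_Icc θ 1)
      (((hy.continuousOn.sub ((continuousOn_driftPrimitive hh).rpow_const
        fun _ _ => Or.inr (by linarith))).add hG.continuousOn).mono hf.Icc_subset)
      (f' := fun v => phaseField q h f c v (y v)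
        - (c + h v) * q * driftPrimitive h c v ^ (q - 1) + q * f v) ?_ ?_ <;> rw [interior_Icc]
    · exact fun v hv => (((hy.hasDerivAt v (hf.Ioo_subset hv)).sub
        ((hasDerivAt_driftPrimitive hh (hf.Ioo_subset hv)).rpow_const (Or.inr hq.le))).add
        (hG.hasDerivAt v (hf.Ioo_subset hv))).hasDerivWithinAt
    · intro v hv
      have hv1 := Ioo_subset_Icc_self (hf.Ioo_subset hv)
      have hyv := hy.nonneg v hv1
      have hpow : y v ^ ((q - 1) / q) ≤ driftPrimitive h c v ^ (q - 1) := by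
        rw [← one_div_mul_eq_div, Real.rpow_mul hyv]
        exact Real.rpow_le_rpow (Real.rpow_nonneg hyv _)
          (hy.root_le_driftPrimitive hq hh hf hc hθ (Ioo_subset_Icc_self hv)) (by linarith)
      have hmul := mul_le_mul_of_nonneg_left hpow
        (mul_nonneg (drift_nonneg hh hc hv1) (by linarith : 0 ≤ q))
      simp only [phaseField]
      linarith
  have hle := hanti (left_mem_Icc.2 hf.mem.2.le) (right_mem_Icc.2 hf.mem.2.le) hf.mem.2.le
  simp only [hy1, hf.integral_threshold] at hle
  linarith

end IsPhaseSol

lemma continuous_driftPrimitive_speed (h : ℝ → ℝ) (v : ℝ) :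
    Continuous fun c => driftPrimitive h c v := by
  unfold driftPrimitive
  fun_prop

/- Shooting: the phase solution lies above `(c v + H(v)) ^ q` at `θ` for the minimal speed, and
below it for large speeds. -/
lemma exists_speed_eq_at_threshold (hq : 1 < q) (hh : ContinuousOn h (Icc 0 1))
    (hf : IsReaction θ f) (hfi : IntervalIntegrable f volume 0 1)
    (hlt : fluxH h 1 < hMin h + (q * ∫ t in (0 : ℝ)..1, f t) ^ (1 / q)) :
    ∃ c y, -hMin h < c ∧ IsPhaseSol q h f c 0 1 y ∧ y 1 = 0 ∧ y θ = driftPrimitive h c θ ^ q := by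
  have hq0 : 0 < q := zero_lt_one.trans hq
  have hθ : θ ∈ Icc (0 : ℝ) 1 := Ioo_subset_Icc_self hf.mem
  set I := ∫ t in (0 : ℝ)..1, f t
  have hI : 0 ≤ q * I := mul_nonneg hq0.le (hf.integral_nonneg (right_mem_Icc.2 zero_le_one))
  have hex : ∀ c, -hMin h ≤ c → ∃ y, IsPhaseSol q h f c 0 1 y ∧ y 1 = 0 :=
    fun c hc => exists_isPhaseSol hq hh hf hfi hc
  choose! y hy using hex
  set c₁ := max (-hMin h + 1) (((q * I) ^ (1 / q) - fluxH h θ) / θ)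
  have hc₁ : -hMin h < c₁ := (lt_add_one _).trans_le (le_max_left _ _)
  have hcont : ContinuousOn (fun c => driftPrimitive h c θ ^ q - y c θ) (Icc (-hMin h) c₁) :=
    ((continuous_driftPrimitive_speed h θ).rpow_const fun _ => Or.inr hq0.le).continuousOn.sub
      ((continuousOn_isPhaseSol_speed hq hh hf hfi hy hθ).mono Icc_subset_Ici_self)
  have hlow : driftPrimitive h (-hMin h) θ ^ q - y (-hMin h) θ < 0 := by
    refine sub_neg.2 (lt_of_not_ge fun hle => ?_)
    have hint := (hy _ le_rfl).1.integral_le_driftPrimitive_rpow (hy _ le_rfl).2 hq hh hf hfi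
      le_rfl hle
    have hroot := (Real.rpow_inv_le_iff_of_pos hI
      (driftPrimitive_nonneg hh le_rfl (right_mem_Icc.2 zero_le_one)) hq0).2 hint
    rw [driftPrimitive, ← one_div] at hroot
    linarith
  have hhigh : 0 < driftPrimitive h c₁ θ ^ q - y c₁ θ := by
    have hroot : (q * I) ^ (1 / q) ≤ driftPrimitive h c₁ θ := by
      rw [driftPrimitive, ← sub_le_iff_le_add]
      exact (div_le_iff₀ hf.mem.1).1 (le_max_right _ _)
    rw [one_div, Real.rpow_inv_le_iff_of_pos hI (driftPrimitive_nonneg hh hc₁.le hθ) hq0] at hroot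
    have hy₁ := hy c₁ hc₁.le
    exact sub_pos.2 ((hy₁.1.lt_integral hy₁.2 hq hh hf hfi hc₁).trans_le hroot)
  obtain ⟨c, hc, hc0⟩ := intermediate_value_Ioo hc₁.le hcont ⟨hlow, hhigh⟩
  exact ⟨c, y c, hc.1, (hy c hc.1.le).1, (hy c hc.1.le).2, (sub_eq_zero.1 hc0).symm⟩

end Shooting

section FluxProfile

variable {q θ c v : ℝ} {h f W : ℝ → ℝ}

/-- `W` is the profile of a decreasing wave of speed `c`: minus its flux, as a function of the
density `v` in `[0, 1]`. -/
structure IsFluxProfile (q : ℝ) (h f : ℝ → ℝ) (c : ℝ) (W : ℝ → ℝ) : Prop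
    extends IsSolOn (fluxField q h f c) 0 1 W where
  zero : W 0 = 0
  one : W 1 = 0
  pos : ∀ v ∈ Ioo (0 : ℝ) 1, 0 < W v

lemma IsPhaseSol.isFluxProfile {y : ℝ → ℝ} (hy : IsPhaseSol q h f c 0 1 y) (hy1 : y 1 = 0)
    (hq : 1 < q) (hh : ContinuousOn h (Icc 0 1)) (hf : IsReaction θ f) (hc : -hMin h < c)
    (hθ : y θ = driftPrimitive h c θ ^ q) : IsFluxProfile q h f c fun v => y v ^ (1 / q) := by
  have hpos : ∀ v ∈ Ioo (0 : ℝ) 1, 0 < y v := by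
    intro v hv
    rcases le_or_gt v θ with hvθ | hvθ
    · rw [hy.eq_driftPrimitive_rpow hq hh hf hc.le hθ ⟨hv.1.le, hvθ⟩]
      exact Real.rpow_pos_of_pos (driftPrimitive_pos hh hc (Ioo_subset_Ioc_self hv)) _
    · exact hy.pos hq hf ⟨hvθ, hv.2⟩
  have hy0 : y 0 = 0 := by
    rw [hy.eq_driftPrimitive_rpow hq hh hf hc.le hθ (left_mem_Icc.2 hf.mem.1.le),
      driftPrimitive_zero, Real.zero_rpow (by linarith)]
  have hroot : (0 : ℝ) ^ (1 / q) = 0 := Real.zero_rpow (by positivity)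
  exact ⟨hy.isSolOn_root hq hpos, by rw [hy0, hroot], by rw [hy1, hroot],
    fun v hv => Real.rpow_pos_of_pos (hpos v hv) _⟩

theorem exists_isFluxProfile (hq : 1 < q) (hh : ContinuousOn h (Icc 0 1)) (hf : IsReaction θ f)
    (hfi : IntervalIntegrable f volume 0 1)
    (hlt : fluxH h 1 < hMin h + (q * ∫ t in (0 : ℝ)..1, f t) ^ (1 / q)) :
    ∃ c W, -hMin h < c ∧ IsFluxProfile q h f c W ∧
      driftPrimitive h c θ < (q * ∫ t in (0 : ℝ)..1, f t) ^ (1 / q) := by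
  obtain ⟨c, y, hc, hy, hy1, hθ⟩ := exists_speed_eq_at_threshold hq hh hf hfi hlt
  have hθ1 : θ ∈ Icc (0 : ℝ) 1 := Ioo_subset_Icc_self hf.mem
  refine ⟨c, _, hc, hy.isFluxProfile hy1 hq hh hf hc hθ, ?_⟩
  rw [one_div, Real.lt_rpow_inv_iff_of_pos (driftPrimitive_nonneg hh hc.le hθ1)
    (mul_nonneg (by linarith) (hf.integral_nonneg (right_mem_Icc.2 zero_le_one))) (by linarith),
    ← hθ]
  exact hy.lt_integral hy1 hq hh hf hfi hc

namespace IsFluxProfile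

lemma eq_driftPrimitive (hW : IsFluxProfile q h f c W) (hh : ContinuousOn h (Icc 0 1))
    (hf : IsReaction θ f) (hv : v ∈ Icc 0 θ) : W v = driftPrimitive h c v := by
  have hv1 : v ≤ 1 := hv.2.trans hf.mem.2.le
  have hconst : W 0 - driftPrimitive h c 0 = W v - driftPrimitive h c v :=
    eq_of_hasDerivAt_zero (f := fun v => W v - driftPrimitive h c v) hv.1
      ((hW.continuousOn.sub (continuousOn_driftPrimitive hh)).mono (Icc_subset_Icc_right hv1))
      fun x hx => by
        have hx1 : x ∈ Ioo (0 : ℝ) 1 := ⟨hx.1, hx.2.trans_le hv1⟩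
        refine ((hW.hasDerivAt x hx1).sub (hasDerivAt_driftPrimitive hh hx1)).congr_deriv ?_
        simp [fluxField, hf.zero x ⟨hx.1, hx.2.le.trans hv.2⟩]
  rw [hW.zero, driftPrimitive_zero, sub_zero] at hconst
  exact sub_eq_zero.1 hconst.symm

lemma le_of_speed_le {c₁ c₂ : ℝ} {W₁ W₂ : ℝ → ℝ} (h₁ : IsFluxProfile q h f c₁ W₁)
    (h₂ : IsFluxProfile q h f c₂ W₂) (hq : 1 < q) (hf : IsReaction θ f) (hc : c₁ ≤ c₂)
    (hv : v ∈ Icc (0 : ℝ) 1) : W₂ v ≤ W₁ v := by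
  refine h₂.toIsSolOn.le h₁.toIsSolOn (h₂.one.trans h₁.one.symm).le (fun x hx hlt => ?_) hv
  have hdiv : f x / W₂ x ^ (q - 1) ≤ f x / W₁ x ^ (q - 1) :=
    div_le_div_of_nonneg_left (hf.nonneg hx) (Real.rpow_pos_of_pos (h₁.pos x hx) _)
      (Real.rpow_le_rpow (h₁.pos x hx).le hlt.le (by linarith))
  simp only [fluxField]
  linarith

lemma speed_le {c₁ c₂ : ℝ} {W₁ W₂ : ℝ → ℝ} (h₁ : IsFluxProfile q h f c₁ W₁)
    (h₂ : IsFluxProfile q h f c₂ W₂) (hq : 1 < q) (hh : ContinuousOn h (Icc 0 1))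
    (hf : IsReaction θ f) : c₂ ≤ c₁ := by
  by_contra! hlt
  have hle := h₁.le_of_speed_le h₂ hq hf hlt.le (Ioo_subset_Icc_self hf.mem)
  have hθ : θ ∈ Icc 0 θ := right_mem_Icc.2 hf.mem.1.le
  rw [h₁.eq_driftPrimitive hh hf hθ, h₂.eq_driftPrimitive hh hf hθ] at hle
  exact hlt.not_ge (le_of_mul_le_mul_right (le_of_add_le_add_right hle) hf.mem.1)

lemma speed_unique {c₁ c₂ : ℝ} {W₁ W₂ : ℝ → ℝ} (h₁ : IsFluxProfile q h f c₁ W₁)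
    (h₂ : IsFluxProfile q h f c₂ W₂) (hq : 1 < q) (hh : ContinuousOn h (Icc 0 1))
    (hf : IsReaction θ f) : c₁ = c₂ :=
  (h₂.speed_le h₁ hq hh hf).antisymm (h₁.speed_le h₂ hq hh hf)

lemma eqOn {W₁ W₂ : ℝ → ℝ} (h₁ : IsFluxProfile q h f c W₁) (h₂ : IsFluxProfile q h f c W₂)
    (hq : 1 < q) (hf : IsReaction θ f) : EqOn W₁ W₂ (Icc 0 1) := fun _ hv =>
  (h₂.le_of_speed_le h₁ hq hf le_rfl hv).antisymm (h₁.le_of_speed_le h₂ hq hf le_rfl hv)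

end IsFluxProfile

end FluxProfile

section DecreasingInverse

/-- The generalized inverse of a strictly decreasing function `X` on `(a, b)`, equal to `a` above
the range of `X` and to `b` below it.  Inserting `a` keeps the supremum away from the empty set. -/
noncomputable def antiInverse (a b : ℝ) (X : ℝ → ℝ) (ξ : ℝ) : ℝ :=
  sSup (insert a {v | v ∈ Ioo a b ∧ ξ ≤ X v})

variable {a b v ξ : ℝ} {X : ℝ → ℝ}

lemma bddAbove_antiInverse_set : BddAbove (insert a {v | v ∈ Ioo a b ∧ ξ ≤ X v}) :=
  (bddAbove_Ioo.mono fun _ hv => hv.1).insert a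

lemma le_antiInverse (hv : v ∈ Ioo a b) (h : ξ ≤ X v) : v ≤ antiInverse a b X ξ :=
  le_csSup bddAbove_antiInverse_set (Or.inr ⟨hv, h⟩)

lemma antiInverse_le (hX : StrictAntiOn X (Ioo a b)) (hv : v ∈ Ioo a b) (h : X v ≤ ξ) :
    antiInverse a b X ξ ≤ v := by
  refine csSup_le (insert_nonempty _ _) ?_
  rintro w (rfl | hw)
  · exact hv.1.le
  · exact (hX.le_iff_ge hv hw.1).1 (h.trans hw.2)

lemma antiInverse_apply (hX : StrictAntiOn X (Ioo a b)) (hv : v ∈ Ioo a b) :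
    antiInverse a b X (X v) = v :=
  (antiInverse_le hX hv le_rfl).antisymm (le_antiInverse hv le_rfl)

lemma antiInverse_mem_Icc (hab : a ≤ b) (ξ : ℝ) : antiInverse a b X ξ ∈ Icc a b := by
  refine ⟨le_csSup bddAbove_antiInverse_set (mem_insert _ _), csSup_le (insert_nonempty _ _) ?_⟩
  rintro w (rfl | hw)
  exacts [hab, hw.1.2.le]

lemma antitone_antiInverse : Antitone (antiInverse a b X) := fun _ _ h =>
  csSup_le_csSup bddAbove_antiInverse_set (insert_nonempty _ _)
    (insert_subset_insert fun _ hv => ⟨hv.1, h.trans hv.2⟩)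

-- A monotone function into `[a, b]` whose range contains `(a, b)` cannot jump.
lemma continuous_antiInverse (hab : a < b) (hX : StrictAntiOn X (Ioo a b)) :
    Continuous (antiInverse a b X) := by
  let U : ℝ → Icc a b := fun ξ => ⟨antiInverse a b X (-ξ), antiInverse_mem_Icc hab.le _⟩
  have hU : Monotone U := fun _ _ h => antitone_antiInverse (neg_le_neg h)
  have hrange : (Subtype.val ⁻¹' Ioo a b : Set (Icc a b)) ⊆ range U := fun v hv =>
    ⟨-X v, Subtype.ext (by simpa only [U, neg_neg] using antiInverse_apply hX hv)⟩
  have hdense : DenseRange U := Dense.mono hrange fun v => by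
    rw [closure_subtype, Subtype.image_preimage_coe, inter_eq_right.2 Ioo_subset_Icc_self,
      closure_Ioo hab.ne]
    exact v.2
  have hcont := (continuous_subtype_val.comp (hU.continuous_of_denseRange hdense)).comp
    continuous_neg
  simpa only [Function.comp_def, U, neg_neg] using hcont

lemma apply_antiInverse (hX : StrictAntiOn X (Ioo a b)) (hXc : ContinuousOn X (Ioo a b))
    (hξ : antiInverse a b X ξ ∈ Ioo a b) : X (antiInverse a b X ξ) = ξ := by
  have hnhds := Ioo_mem_nhds hξ.1 hξ.2
  have hlim (s : Set ℝ) : Tendsto X (𝓝[s] antiInverse a b X ξ) (𝓝 (X (antiInverse a b X ξ))) :=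
    (hXc.continuousAt hnhds).tendsto.mono_left nhdsWithin_le_nhds
  have hright : ∀ᶠ v in 𝓝[>] antiInverse a b X ξ, X v ≤ ξ := by
    filter_upwards [self_mem_nhdsWithin, nhdsWithin_le_nhds hnhds] with v hlt hv
    exact (lt_of_not_ge fun h => hlt.not_ge (le_antiInverse hv h)).le
  have hleft : ∀ᶠ v in 𝓝[<] antiInverse a b X ξ, ξ ≤ X v := by
    filter_upwards [self_mem_nhdsWithin, nhdsWithin_le_nhds hnhds] with v hlt hv
    exact (lt_of_not_ge fun h => hlt.not_ge (antiInverse_le hX hv h)).le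
  exact (le_of_tendsto (hlim _) hright).antisymm (ge_of_tendsto (hlim _) hleft)

lemma tendsto_antiInverse_atBot (hab : a < b) : Tendsto (antiInverse a b X) atBot (𝓝 b) := by
  refine tendsto_order.2 ⟨fun w hw => ?_, fun w hw =>
    Eventually.of_forall fun ξ => (antiInverse_mem_Icc hab.le ξ).2.trans_lt hw⟩
  obtain ⟨v, hmax, hvb⟩ := exists_between (max_lt hw hab)
  filter_upwards [eventually_le_atBot (X v)] with ξ hξ
  exact ((le_max_left _ _).trans_lt hmax).trans_le
    (le_antiInverse ⟨(le_max_right _ _).trans_lt hmax, hvb⟩ hξ)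

lemma tendsto_antiInverse_atTop (hab : a < b) (hX : StrictAntiOn X (Ioo a b)) :
    Tendsto (antiInverse a b X) atTop (𝓝 a) := by
  refine tendsto_order.2 ⟨fun w hw =>
    Eventually.of_forall fun ξ => hw.trans_le (antiInverse_mem_Icc hab.le ξ).1, fun w hw => ?_⟩
  obtain ⟨v, hav, hmin⟩ := exists_between (lt_min hw hab)
  filter_upwards [eventually_ge_atTop (X v)] with ξ hξ
  exact (antiInverse_le hX ⟨hav, hmin.trans_le (min_le_right _ _)⟩ hξ).trans_lt
    (hmin.trans_le (min_le_left _ _))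

/- Separation of variables; `A` may be singular at `a` and `b`, and `u` may reach these values in
finite time. -/
lemma exists_decreasing_wave {A : ℝ → ℝ} (hab : a < b) (hA : ContinuousOn A (Ioo a b))
    (hpos : ∀ v ∈ Ioo a b, 0 < A v) :
    ∃ u : ℝ → ℝ, Continuous u ∧ (∀ ξ, u ξ ∈ Icc a b) ∧
      (∀ ξ, u ξ ∈ Ioo a b → HasDerivAt u (-A (u ξ)) ξ) ∧
      Tendsto u atBot (𝓝 b) ∧ Tendsto u atTop (𝓝 a) := by
  have hB : ContinuousOn (fun v => -(A v)⁻¹) (Ioo a b) :=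
    (hA.inv₀ fun v hv => (hpos v hv).ne').neg
  obtain ⟨m, hm⟩ := nonempty_Ioo.2 hab
  let X : ℝ → ℝ := fun v => ∫ t in m..v, -(A t)⁻¹
  have hXd (v) (hv : v ∈ Ioo a b) : HasDerivAt X (-(A v)⁻¹) v :=
    intervalIntegral.integral_hasDerivAt_right
      (hB.mono (ordConnected_Ioo.uIcc_subset hm hv)).intervalIntegrable
      (hB.stronglyMeasurableAtFilter isOpen_Ioo v hv) (hB.continuousAt (Ioo_mem_nhds hv.1 hv.2))
  have hXc : ContinuousOn X (Ioo a b) := fun v hv => (hXd v hv).continuousAt.continuousWithinAt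
  have hX : StrictAntiOn X (Ioo a b) := by
    refine strictAntiOn_of_deriv_neg (convex_Ioo a b) hXc fun v hv => ?_
    rw [interior_Ioo] at hv
    rw [(hXd v hv).deriv]
    exact neg_neg_of_pos (inv_pos.2 (hpos v hv))
  have huc := continuous_antiInverse hab hX
  refine ⟨antiInverse a b X, huc, antiInverse_mem_Icc hab.le, fun ξ hξ => ?_,
    tendsto_antiInverse_atBot hab, tendsto_antiInverse_atTop hab hX⟩
  have hinv : ∀ᶠ η in 𝓝 ξ, X (antiInverse a b X η) = η := by
    filter_upwards [huc.continuousAt (Ioo_mem_nhds hξ.1 hξ.2)] with η hη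
    exact apply_antiInverse hX hXc hη
  exact (HasDerivAt.of_local_left_inverse huc.continuousAt (hXd _ hξ)
    (neg_ne_zero.2 (inv_ne_zero (hpos _ hξ).ne')) hinv).congr_deriv (by rw [inv_neg, inv_inv])

end DecreasingInverse

section Reconstruction

variable {p c : ℝ} {D h g u W : ℝ → ℝ}

lemma abs_rpow_sub_two_mul_of_neg {r : ℝ} (hr : r < 0) : |r| ^ (p - 2) * r = -(-r) ^ (p - 1) := by
  have hr' : 0 < -r := neg_pos.2 hr
  rw [abs_of_neg hr, show p - 1 = (p - 2) + 1 by ring, Real.rpow_add_one hr'.ne']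
  ring

lemma isOpen_interiorSet (hu : Continuous u) : IsOpen (interiorSet u) :=
  isOpen_Ioo.preimage hu

lemma diffFlux_of_mem {ξ : ℝ} (hξ : ξ ∈ interiorSet u) :
    diffFlux p D u ξ = D (u ξ) * (|deriv u ξ| ^ (p - 2) * deriv u ξ) := if_pos hξ

lemma diffFlux_of_notMem {ξ : ℝ} (hξ : ξ ∉ interiorSet u) : diffFlux p D u ξ = 0 := if_neg hξ

lemma eq_zero_or_one_of_notMem {ξ : ℝ} (hmem : u ξ ∈ Icc (0 : ℝ) 1) (hξ : ξ ∉ interiorSet u) :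
    u ξ = 0 ∨ u ξ = 1 := by
  by_contra! hne
  exact hξ ⟨hmem.1.lt_of_ne hne.1.symm, hmem.2.lt_of_ne hne.2⟩

lemma one_lt_conjExponent (hp : 1 < p) : 1 < Real.conjExponent p :=
  (Real.HolderConjugate.conjExponent hp).symm.lt

lemma sub_one_mul_conjExponent_sub_one (hp : 1 < p) :
    (p - 1) * (Real.conjExponent p - 1) = 1 := by
  linear_combination (Real.HolderConjugate.conjExponent hp).sub_one_mul_conj

lemma IsReaction.weight {θ : ℝ} (hg : IsReaction θ g) (hD : ContinuousOn D (Ioo 0 1))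
    (hDpos : ∀ v ∈ Ioo (0 : ℝ) 1, 0 < D v) : IsReaction θ (weight p D g) where
  mem := hg.mem
  continuousOn := (hD.rpow_const fun v hv => Or.inl (hDpos v hv).ne').mul hg.continuousOn
  zero v hv := by rw [CombustionWave.weight, hg.zero v hv, mul_zero]
  pos v hv := mul_pos (Real.rpow_pos_of_pos (hDpos v (hg.Ioo_subset hv)) _) (hg.pos v hv)

/-- The slope `-u'` of a decreasing wave whose flux at height `v` is `-W v`. -/
noncomputable def waveSlope (p : ℝ) (D W : ℝ → ℝ) (v : ℝ) : ℝ :=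
  (W v / D v) ^ (Real.conjExponent p - 1)

lemma waveSlope_pos {v : ℝ} (hDv : 0 < D v) (hWv : 0 < W v) : 0 < waveSlope p D W v :=
  Real.rpow_pos_of_pos (div_pos hWv hDv) _

lemma waveSlope_rpow {v : ℝ} (hp : 1 < p) (hDv : 0 < D v) (hWv : 0 < W v) :
    waveSlope p D W v ^ (p - 1) = W v / D v := by
  rw [waveSlope, ← Real.rpow_mul (div_pos hWv hDv).le, mul_comm,
    sub_one_mul_conjExponent_sub_one hp, Real.rpow_one]

lemma weight_div_rpow_mul_waveSlope {v : ℝ} (hDv : 0 < D v) (hWv : 0 < W v) :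
    weight p D g v / W v ^ (Real.conjExponent p - 1) * waveSlope p D W v = g v := by
  have hDr := (Real.rpow_pos_of_pos hDv (Real.conjExponent p - 1)).ne'
  have hWr := (Real.rpow_pos_of_pos hWv (Real.conjExponent p - 1)).ne'
  rw [waveSlope, weight, Real.div_rpow hWv.le hDv.le]
  field_simp

lemma continuousOn_waveSlope (hD : ContinuousOn D (Ioo 0 1)) (hDpos : ∀ v ∈ Ioo (0 : ℝ) 1, 0 < D v)
    (hW : ContinuousOn W (Ioo 0 1)) (hWpos : ∀ v ∈ Ioo (0 : ℝ) 1, 0 < W v) :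
    ContinuousOn (waveSlope p D W) (Ioo 0 1) :=
  (hW.div hD fun v hv => (hDpos v hv).ne').rpow_const fun v hv =>
    Or.inl (div_pos (hWpos v hv) (hDpos v hv)).ne'

lemma diffFlux_eq_neg (hp : 1 < p) (hDpos : ∀ v ∈ Ioo (0 : ℝ) 1, 0 < D v)
    (hWpos : ∀ v ∈ Ioo (0 : ℝ) 1, 0 < W v) (hW0 : W 0 = 0) (hW1 : W 1 = 0)
    (hu : ∀ ξ, u ξ ∈ Icc (0 : ℝ) 1)
    (hud : ∀ ξ ∈ interiorSet u, HasDerivAt u (-waveSlope p D W (u ξ)) ξ) (ξ : ℝ) :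
    diffFlux p D u ξ = -W (u ξ) := by
  by_cases hξ : ξ ∈ interiorSet u
  · have hDξ := hDpos _ hξ
    have hWξ := hWpos _ hξ
    rw [diffFlux_of_mem hξ, (hud ξ hξ).deriv,
      abs_rpow_sub_two_mul_of_neg (neg_neg_of_pos (waveSlope_pos hDξ hWξ)), neg_neg,
      waveSlope_rpow hp hDξ hWξ, mul_neg, mul_div_cancel₀ _ hDξ.ne']
  · rw [diffFlux_of_notMem hξ]
    rcases eq_zero_or_one_of_notMem (hu ξ) hξ with h0 | h1
    · rw [h0, hW0, neg_zero]
    · rw [h1, hW1, neg_zero]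

lemma tendsto_neg_comp (hW : ContinuousOn W (Icc 0 1)) (hu : ∀ ξ, u ξ ∈ Icc (0 : ℝ) 1) {w : ℝ}
    (hw : w ∈ Icc (0 : ℝ) 1) (hWw : W w = 0) :
    Tendsto (fun ξ => -W (u ξ)) (comap u (𝓝 w)) (𝓝 0) := by
  have hin : Tendsto u (comap u (𝓝 w)) (𝓝[Icc 0 1] w) :=
    tendsto_nhdsWithin_iff.2 ⟨tendsto_comap, Eventually.of_forall hu⟩
  simpa only [hWw, neg_zero, Function.comp_def] using ((hW w hw).tendsto.comp hin).neg

namespace IsFluxProfile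

lemma hasDerivAt_neg_comp (hW : IsFluxProfile (Real.conjExponent p) h (weight p D g) c W)
    (hDpos : ∀ v ∈ Ioo (0 : ℝ) 1, 0 < D v) {ξ : ℝ} (hξ : ξ ∈ interiorSet u)
    (hud : HasDerivAt u (-waveSlope p D W (u ξ)) ξ) :
    HasDerivAt (fun ξ => -W (u ξ)) ((c + h (u ξ)) * waveSlope p D W (u ξ) - g (u ξ)) ξ := by
  refine ((hW.hasDerivAt (u ξ) hξ).comp ξ hud).neg.congr_deriv ?_
  rw [← weight_div_rpow_mul_waveSlope (p := p) (g := g) (hDpos _ hξ) (hW.pos _ hξ), fluxField]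
  ring

theorem exists_isSolution (hW : IsFluxProfile (Real.conjExponent p) h (weight p D g) c W)
    (hp : 1 < p) (hD : ContinuousOn D (Ioo 0 1)) (hDpos : ∀ v ∈ Ioo (0 : ℝ) 1, 0 < D v) :
    ∃ u, IsSolution p D h g c u := by
  have hAc : ContinuousOn (waveSlope p D W) (Ioo 0 1) :=
    continuousOn_waveSlope hD hDpos (hW.continuousOn.mono Ioo_subset_Icc_self) hW.pos
  obtain ⟨u, huc, hu, hud, hbot, htop⟩ := exists_decreasing_wave zero_lt_one hAc
    fun v hv => waveSlope_pos (hDpos v hv) (hW.pos v hv)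
  have hflux : diffFlux p D u = fun ξ => -W (u ξ) :=
    funext (diffFlux_eq_neg hp hDpos hW.pos hW.zero hW.one hu hud)
  have hfluxd (ξ) (hξ : ξ ∈ interiorSet u) :
      HasDerivAt (diffFlux p D u) ((c + h (u ξ)) * waveSlope p D W (u ξ) - g (u ξ)) ξ :=
    hflux ▸ hW.hasDerivAt_neg_comp hDpos hξ (hud ξ hξ)
  exact ⟨u,
    { continuous := huc
      mem_Icc := hu
      contDiffOn := by
        rw [show (1 : WithTop ℕ∞) = 0 + 1 from (zero_add 1).symm,
          contDiffOn_succ_iff_deriv_of_isOpen (isOpen_interiorSet huc), contDiffOn_zero]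
        exact ⟨fun ξ hξ => (hud ξ hξ).differentiableAt.differentiableWithinAt, by simp,
          (hAc.comp huc.continuousOn fun _ hξ => hξ).neg.congr fun ξ hξ => (hud ξ hξ).deriv⟩
      flux_differentiableAt := fun ξ hξ => (hfluxd ξ hξ).differentiableAt
      equation := fun ξ hξ => by
        rw [(hfluxd ξ hξ).deriv, (hud ξ hξ).deriv]
        ring
      flux_continuous := hflux ▸ (hW.continuousOn.comp_continuous huc hu).neg
      flux_tendsto_zero := hflux ▸ tendsto_neg_comp hW.continuousOn hu (by simp) hW.zero
      flux_tendsto_one := hflux ▸ tendsto_neg_comp hW.continuousOn hu (by simp) hW.one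
      tendsto_atBot := hbot
      tendsto_atTop := htop }⟩

end IsFluxProfile

end Reconstruction

section Monotonicity

variable {p θ c ξ : ℝ} {D h g u : ℝ → ℝ}

-- Take the last minimizer of `u` on `[a, b]`.
lemma exists_isLocalMin_lt_of_lt {a m b : ℝ} (hu : Continuous u) (ham : a ≤ m) (hmb : m ≤ b)
    (ha : u m < u a) (hb : u m < u b) :
    ∃ x ∈ Ioo a b, IsLocalMin u x ∧ ∀ y ∈ Ioc x b, u x < u y := by
  have hm : m ∈ Icc a b := ⟨ham, hmb⟩
  obtain ⟨x₀, hx₀, hmin⟩ := isCompact_Icc.exists_isMinOn ⟨m, hm⟩ hu.continuousOn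
  have hcompact : IsCompact (Icc a b ∩ u ⁻¹' {u x₀}) :=
    isCompact_Icc.inter_right (isClosed_singleton.preimage hu)
  obtain ⟨x, ⟨hx, hux⟩, hlast⟩ := hcompact.exists_isGreatest ⟨x₀, hx₀, rfl⟩
  have hle : ∀ y ∈ Icc a b, u x ≤ u y := fun y hy => hux.trans_le (hmin hy)
  have hxa : a ≠ x := by
    rintro rfl
    exact (hle m hm).not_gt ha
  have hxb : x ≠ b := by
    rintro rfl
    exact (hle m hm).not_gt hb
  have hxI : x ∈ Ioo a b := ⟨hx.1.lt_of_ne hxa, hx.2.lt_of_ne hxb⟩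
  refine ⟨x, hxI, ?_, fun y hy => ?_⟩
  · filter_upwards [Icc_mem_nhds hxI.1 hxI.2] with y hy using hle y hy
  · have hyI : y ∈ Icc a b := ⟨hx.1.trans hy.1.le, hy.2⟩
    exact (hle y hyI).lt_of_ne fun heq => hy.1.not_ge (hlast ⟨hyI, heq.symm.trans hux⟩)

lemma sign_diffFlux (hDpos : ∀ v ∈ Ioo (0 : ℝ) 1, 0 < D v) (hξ : ξ ∈ interiorSet u) :
    SignType.sign (diffFlux p D u ξ) = SignType.sign (deriv u ξ) := by
  rw [diffFlux_of_mem hξ, sign_mul, sign_mul, sign_pos (hDpos _ hξ), one_mul]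
  rcases eq_or_ne (deriv u ξ) 0 with h0 | h0
  · rw [h0, sign_zero, mul_zero]
  · rw [sign_pos (Real.rpow_pos_of_pos (abs_pos.2 h0) _), one_mul]

lemma diffFlux_pos_iff (hDpos : ∀ v ∈ Ioo (0 : ℝ) 1, 0 < D v) (hξ : ξ ∈ interiorSet u) :
    0 < diffFlux p D u ξ ↔ 0 < deriv u ξ := by
  rw [← sign_eq_one_iff, sign_diffFlux hDpos hξ, sign_eq_one_iff]

lemma diffFlux_neg_iff (hDpos : ∀ v ∈ Ioo (0 : ℝ) 1, 0 < D v) (hξ : ξ ∈ interiorSet u) :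
    diffFlux p D u ξ < 0 ↔ deriv u ξ < 0 := by
  rw [← sign_eq_neg_one_iff, sign_diffFlux hDpos hξ, sign_eq_neg_one_iff]

lemma diffFlux_eq_zero_iff (hDpos : ∀ v ∈ Ioo (0 : ℝ) 1, 0 < D v) (hξ : ξ ∈ interiorSet u) :
    diffFlux p D u ξ = 0 ↔ deriv u ξ = 0 := by
  rw [← sign_eq_zero_iff, sign_diffFlux hDpos hξ, sign_eq_zero_iff]

lemma diffFlux_eq_zero_of_isLocalMin (hDpos : ∀ v ∈ Ioo (0 : ℝ) 1, 0 < D v)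
    (hmin : IsLocalMin u ξ) : diffFlux p D u ξ = 0 := by
  by_cases hξ : ξ ∈ interiorSet u
  · exact (diffFlux_eq_zero_iff hDpos hξ).2 hmin.deriv_eq_zero
  · exact diffFlux_of_notMem hξ

lemma diffFlux_nonpos (hDpos : ∀ v ∈ Ioo (0 : ℝ) 1, 0 < D v) (hanti : Antitone u) (ξ : ℝ) :
    diffFlux p D u ξ ≤ 0 := by
  by_cases hξ : ξ ∈ interiorSet u
  · exact not_lt.1 fun hpos => ((diffFlux_pos_iff hDpos hξ).1 hpos).not_ge hanti.deriv_nonpos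
  · exact (diffFlux_of_notMem hξ).le

/-- The total flux `D(u) |u'| ^ (p - 2) u' + c u + H(u)` of a wave: the equation says that its
derivative is `-g(u)`. -/
noncomputable def totalFlux (p : ℝ) (D h : ℝ → ℝ) (c : ℝ) (u : ℝ → ℝ) (ξ : ℝ) : ℝ :=
  diffFlux p D u ξ + driftPrimitive h c (u ξ)

namespace IsSolution

lemma isOpen (hu : IsSolution p D h g c u) : IsOpen (interiorSet u) :=
  isOpen_interiorSet hu.continuous

lemma hasStrictDerivAt (hu : IsSolution p D h g c u) (hξ : ξ ∈ interiorSet u) :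
    HasStrictDerivAt u (deriv u ξ) ξ :=
  (hu.contDiffOn.contDiffAt (hu.isOpen.mem_nhds hξ)).hasStrictDerivAt one_ne_zero

lemma hasDerivAt (hu : IsSolution p D h g c u) (hξ : ξ ∈ interiorSet u) :
    HasDerivAt u (deriv u ξ) ξ := (hu.hasStrictDerivAt hξ).hasDerivAt

lemma hasDerivAt_diffFlux (hu : IsSolution p D h g c u) (hξ : ξ ∈ interiorSet u) :
    HasDerivAt (diffFlux p D u) (-((c + h (u ξ)) * deriv u ξ) - g (u ξ)) ξ :=
  (hu.flux_differentiableAt ξ hξ).hasDerivAt.congr_deriv (by linarith [hu.equation ξ hξ])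

lemma hasDerivAt_totalFlux (hu : IsSolution p D h g c u) (hh : ContinuousOn h (Icc 0 1))
    (hξ : ξ ∈ interiorSet u) : HasDerivAt (totalFlux p D h c u) (-g (u ξ)) ξ :=
  ((hu.hasDerivAt_diffFlux hξ).add
    ((hasDerivAt_driftPrimitive (v := u ξ) hh hξ).comp ξ (hu.hasDerivAt hξ))).congr_deriv (by ring)

lemma continuous_totalFlux (hu : IsSolution p D h g c u) (hh : ContinuousOn h (Icc 0 1)) :
    Continuous (totalFlux p D h c u) :=
  hu.flux_continuous.add
    ((continuousOn_driftPrimitive hh).comp_continuous hu.continuous hu.mem_Icc)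

lemma antitoneOn_totalFlux (hu : IsSolution p D h g c u) (hh : ContinuousOn h (Icc 0 1))
    (hg : IsReaction θ g) {x y : ℝ} (hI : Ioo x y ⊆ interiorSet u) :
    AntitoneOn (totalFlux p D h c u) (Icc x y) := by
  refine antitoneOn_of_hasDerivWithinAt_nonpos (f' := fun ξ => -g (u ξ)) (convex_Icc x y)
    (hu.continuous_totalFlux hh).continuousOn ?_ ?_ <;> rw [interior_Icc]
  · exact fun z hz => (hu.hasDerivAt_totalFlux hh (hI hz)).hasDerivWithinAt
  · exact fun z hz => neg_nonpos.2 (hg.nonneg (hI hz))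

/- A rise of `u` starts at a local minimum `x`, where the flux vanishes; at a later point with
positive slope both the flux and the drift primitive are larger than at `x`, whereas the total flux
decreases. -/
lemma antitone (hu : IsSolution p D h g c u) (hDpos : ∀ v ∈ Ioo (0 : ℝ) 1, 0 < D v)
    (hh : ContinuousOn h (Icc 0 1)) (hg : IsReaction θ g) (hc : -hMin h < c) : Antitone u := by
  intro m b hmb
  by_contra! hrise
  obtain ⟨a, ham, ha⟩ : ∃ a, a ≤ m ∧ u m < u a := ((eventually_le_atBot m).and
    (hu.tendsto_atBot.eventually (lt_mem_nhds (hrise.trans_le (hu.mem_Icc b).2)))).exists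
  obtain ⟨x, hx, hmin, hlast⟩ := exists_isLocalMin_lt_of_lt hu.continuous ham hmb ha hrise
  have hux1 : u x < 1 := (hlast b (right_mem_Ioc.2 hx.2)).trans_le (hu.mem_Icc b).2
  obtain ⟨z, ⟨hxz, hzb⟩, hz⟩ := (mem_nhdsGT_iff_exists_mem_Ioc_Ioo_subset hx.2).1
    (mem_nhdsWithin_of_mem_nhds (hu.continuous.continuousAt (gt_mem_nhds hux1)))
  have hlt : ∀ y ∈ Ioc x z, u x < u y := fun y hy => hlast y ⟨hy.1, hy.2.trans hzb⟩
  have hI : Ioo x z ⊆ interiorSet u := fun y hy =>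
    ⟨(hu.mem_Icc x).1.trans_lt (hlt y (Ioo_subset_Ioc_self hy)), hz hy⟩
  obtain ⟨y, hy, hslope⟩ := exists_hasDerivAt_eq_slope u (deriv u) hxz hu.continuous.continuousOn
    fun y hy => hu.hasDerivAt (hI hy)
  have hflux : 0 < diffFlux p D u y := by
    rw [diffFlux_pos_iff hDpos (hI hy), hslope]
    exact div_pos (sub_pos.2 (hlt z (right_mem_Ioc.2 hxz))) (sub_pos.2 hxz)
  have hprim : driftPrimitive h c (u x) < driftPrimitive h c (u y) :=
    strictMonoOn_driftPrimitive hh hc (hu.mem_Icc x) (hu.mem_Icc y)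
      (hlt y (Ioo_subset_Ioc_self hy))
  have htotal : totalFlux p D h c u y ≤ totalFlux p D h c u x :=
    hu.antitoneOn_totalFlux hh hg hI (left_mem_Icc.2 hxz.le) (Ioo_subset_Icc_self hy) hy.1.le
  rw [totalFlux, totalFlux, diffFlux_eq_zero_of_isLocalMin hDpos hmin] at htotal
  linarith

lemma exists_eq (hu : IsSolution p D h g c u) {v : ℝ} (hv : v ∈ Ioo (0 : ℝ) 1) : ∃ ξ, u ξ = v :=
  mem_range_of_exists_le_of_exists_ge hu.continuous
    ((hu.tendsto_atTop.eventually (gt_mem_nhds hv.1)).exists.imp fun _ => le_of_lt)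
    ((hu.tendsto_atBot.eventually (lt_mem_nhds hv.2)).exists.imp fun _ => le_of_lt)

lemma le_threshold_of_diffFlux_eq_zero (hu : IsSolution p D h g c u)
    (hDpos : ∀ v ∈ Ioo (0 : ℝ) 1, 0 < D v) (hg : IsReaction θ g) (hanti : Antitone u)
    (hξ : ξ ∈ interiorSet u) (hflux : diffFlux p D u ξ = 0) : u ξ ≤ θ := by
  have hmax : IsLocalMax (diffFlux p D u) ξ :=
    Eventually.of_forall fun y => (diffFlux_nonpos hDpos hanti y).trans hflux.ge
  have hzero := hmax.hasDerivAt_eq_zero (hu.hasDerivAt_diffFlux hξ)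
  rw [(diffFlux_eq_zero_iff hDpos hξ).1 hflux, mul_zero, neg_zero, zero_sub, neg_eq_zero] at hzero
  exact not_lt.1 fun hlt => (hg.pos _ ⟨hlt, hξ.2⟩).ne' hzero

/- Below the threshold the total flux is constant, so a flux vanishing at `ξ` would have to become
positive further on. -/
lemma diffFlux_neg (hu : IsSolution p D h g c u) (hDpos : ∀ v ∈ Ioo (0 : ℝ) 1, 0 < D v)
    (hh : ContinuousOn h (Icc 0 1)) (hg : IsReaction θ g) (hc : -hMin h < c)
    (hξ : ξ ∈ interiorSet u) : diffFlux p D u ξ < 0 := by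
  have hanti := hu.antitone hDpos hh hg hc
  refine (diffFlux_nonpos hDpos hanti ξ).lt_of_ne fun hflux => ?_
  have hle := hu.le_threshold_of_diffFlux_eq_zero hDpos hg hanti hξ hflux
  obtain ⟨v, hv0, hvξ⟩ := exists_between hξ.1
  obtain ⟨η, rfl⟩ := hu.exists_eq ⟨hv0, hvξ.trans hξ.2⟩
  have hξη : ξ ≤ η := (hanti.reflect_lt hvξ).le
  have hconst : totalFlux p D h c u ξ = totalFlux p D h c u η := by
    refine eq_of_hasDerivAt_zero hξη (hu.continuous_totalFlux hh).continuousOn fun x hx => ?_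
    have hx0 : 0 < u x := hv0.trans_le (hanti hx.2.le)
    have hxξ : u x ≤ u ξ := hanti hx.1.le
    have hd := hu.hasDerivAt_totalFlux hh ⟨hx0, hxξ.trans_lt hξ.2⟩
    rwa [hg.zero _ ⟨hx0, hxξ.trans hle⟩, neg_zero] at hd
  have hprim : driftPrimitive h c (u η) < driftPrimitive h c (u ξ) :=
    strictMonoOn_driftPrimitive hh hc (hu.mem_Icc η) (hu.mem_Icc ξ) hvξ
  rw [totalFlux, totalFlux, hflux] at hconst
  linarith [diffFlux_nonpos (p := p) hDpos hanti η]

lemma deriv_neg (hu : IsSolution p D h g c u) (hDpos : ∀ v ∈ Ioo (0 : ℝ) 1, 0 < D v)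
    (hh : ContinuousOn h (Icc 0 1)) (hg : IsReaction θ g) (hc : -hMin h < c)
    (hξ : ξ ∈ interiorSet u) : deriv u ξ < 0 :=
  (diffFlux_neg_iff hDpos hξ).1 (hu.diffFlux_neg hDpos hh hg hc hξ)

lemma strictAntiOn (hu : IsSolution p D h g c u) (hDpos : ∀ v ∈ Ioo (0 : ℝ) 1, 0 < D v)
    (hh : ContinuousOn h (Icc 0 1)) (hg : IsReaction θ g) (hc : -hMin h < c) :
    StrictAntiOn u (interiorSet u) := by
  have hconv : Convex ℝ (interiorSet u) :=
    (ordConnected_Ioo.preimage_anti (hu.antitone hDpos hh hg hc)).convex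
  exact strictAntiOn_of_deriv_neg hconv hu.continuous.continuousOn fun ξ hξ =>
    hu.deriv_neg hDpos hh hg hc (interior_subset hξ)

end IsSolution

end Monotonicity

section ProfileOfSolution

variable {p θ c ξ v : ℝ} {D h g u : ℝ → ℝ}

/-- The profile of a wave: minus its flux as a function of the density, extended by `0` to the
endpoints, where `Function.invFun u` carries no information. -/
noncomputable def fluxProfile (p : ℝ) (D u : ℝ → ℝ) : ℝ → ℝ :=
  indicator (Ioo 0 1) fun v => -diffFlux p D u (Function.invFun u v)

lemma fluxProfile_apply (hv : v ∈ Ioo (0 : ℝ) 1) :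
    fluxProfile p D u v = -diffFlux p D u (Function.invFun u v) :=
  indicator_of_mem hv _

namespace IsSolution

lemma apply_invFun (hu : IsSolution p D h g c u) (hv : v ∈ Ioo (0 : ℝ) 1) :
    u (Function.invFun u v) = v := Function.invFun_eq (hu.exists_eq hv)

lemma invFun_mem (hu : IsSolution p D h g c u) (hv : v ∈ Ioo (0 : ℝ) 1) :
    Function.invFun u v ∈ interiorSet u := by
  change u (Function.invFun u v) ∈ Ioo 0 1
  rwa [hu.apply_invFun hv]

lemma invFun_apply (hu : IsSolution p D h g c u) (hstrict : StrictAntiOn u (interiorSet u))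
    (hξ : ξ ∈ interiorSet u) : Function.invFun u (u ξ) = ξ :=
  hstrict.injOn (hu.invFun_mem hξ) hξ (hu.apply_invFun hξ)

lemma hasDerivAt_invFun (hu : IsSolution p D h g c u) (hstrict : StrictAntiOn u (interiorSet u))
    (hneg : ∀ ξ ∈ interiorSet u, deriv u ξ < 0) (hv : v ∈ Ioo (0 : ℝ) 1) :
    HasDerivAt (Function.invFun u) (deriv u (Function.invFun u v))⁻¹ v := by
  have hmem := hu.invFun_mem hv
  have hleft : ∀ᶠ ξ in 𝓝 (Function.invFun u v), Function.invFun u (u ξ) = ξ := by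
    filter_upwards [hu.isOpen.mem_nhds hmem] with ξ hξ using hu.invFun_apply hstrict hξ
  simpa only [hu.apply_invFun hv] using
    ((hu.hasStrictDerivAt hmem).to_local_left_inverse (hneg _ hmem).ne hleft).hasDerivAt

lemma fluxProfile_pos (hu : IsSolution p D h g c u) (hDpos : ∀ v ∈ Ioo (0 : ℝ) 1, 0 < D v)
    (hneg : ∀ ξ ∈ interiorSet u, deriv u ξ < 0) (hv : v ∈ Ioo (0 : ℝ) 1) :
    0 < fluxProfile p D u v := by
  have hmem := hu.invFun_mem hv
  rw [fluxProfile_apply hv]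
  exact neg_pos.2 ((diffFlux_neg_iff hDpos hmem).2 (hneg _ hmem))

lemma deriv_invFun (hu : IsSolution p D h g c u) (hp : 1 < p)
    (hDpos : ∀ v ∈ Ioo (0 : ℝ) 1, 0 < D v) (hneg : ∀ ξ ∈ interiorSet u, deriv u ξ < 0)
    (hv : v ∈ Ioo (0 : ℝ) 1) :
    deriv u (Function.invFun u v) = -waveSlope p D (fluxProfile p D u) v := by
  have hmem := hu.invFun_mem hv
  have hr := neg_pos.2 (hneg _ hmem)
  rw [waveSlope, fluxProfile_apply hv, diffFlux_of_mem hmem,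
    abs_rpow_sub_two_mul_of_neg (hneg _ hmem), hu.apply_invFun hv, mul_neg, neg_neg,
    mul_div_cancel_left₀ _ (hDpos v hv).ne', ← Real.rpow_mul hr.le,
    sub_one_mul_conjExponent_sub_one hp, Real.rpow_one, neg_neg]

lemma hasDerivAt_fluxProfile (hu : IsSolution p D h g c u) (hp : 1 < p)
    (hDpos : ∀ v ∈ Ioo (0 : ℝ) 1, 0 < D v) (hstrict : StrictAntiOn u (interiorSet u))
    (hneg : ∀ ξ ∈ interiorSet u, deriv u ξ < 0) (hv : v ∈ Ioo (0 : ℝ) 1) :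
    HasDerivAt (fluxProfile p D u)
      (fluxField (Real.conjExponent p) h (weight p D g) c v (fluxProfile p D u v)) v := by
  have hW := hu.fluxProfile_pos (p := p) hDpos hneg hv
  have hd := ((hu.hasDerivAt_diffFlux (hu.invFun_mem hv)).comp v
    (hu.hasDerivAt_invFun hstrict hneg hv)).neg
  have heq : fluxProfile p D u =ᶠ[𝓝 v] fun v => -diffFlux p D u (Function.invFun u v) := by
    filter_upwards [Ioo_mem_nhds hv.1 hv.2] with w hw using fluxProfile_apply hw
  refine (hd.congr_of_eventuallyEq heq).congr_deriv ?_
  have hslope := (waveSlope_pos (p := p) (hDpos v hv) hW).ne'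
  rw [hu.apply_invFun hv, hu.deriv_invFun hp hDpos hneg hv, fluxField,
    ← weight_div_rpow_mul_waveSlope (g := g) (hDpos v hv) hW]
  field_simp

lemma continuousAt_fluxProfile (hu : IsSolution p D h g c u) {w : ℝ} (hw : w ∉ Ioo (0 : ℝ) 1)
    (hlim : Tendsto (diffFlux p D u) (comap u (𝓝 w)) (𝓝 0)) :
    ContinuousAt (fluxProfile p D u) w := by
  classical
  have hinv : Tendsto (Function.invFun u) (𝓝 w ⊓ 𝓟 (Ioo 0 1)) (comap u (𝓝 w)) := by
    refine tendsto_comap_iff.2 (tendsto_id.mono_left inf_le_left |>.congr' ?_)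
    filter_upwards [mem_inf_of_right (mem_principal_self (Ioo (0 : ℝ) 1))] with v hv
    exact (hu.apply_invFun hv).symm
  have hflux := (hlim.comp hinv).neg
  rw [neg_zero] at hflux
  rw [ContinuousAt, fluxProfile, indicator_of_notMem hw, ← piecewise_eq_indicator]
  exact hflux.piecewise tendsto_const_nhds

theorem isFluxProfile (hu : IsSolution p D h g c u) (hp : 1 < p)
    (hDpos : ∀ v ∈ Ioo (0 : ℝ) 1, 0 < D v) (hh : ContinuousOn h (Icc 0 1)) (hg : IsReaction θ g)
    (hc : -hMin h < c) :
    IsFluxProfile (Real.conjExponent p) h (weight p D g) c (fluxProfile p D u) := by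
  have hneg (ξ : ℝ) (hξ : ξ ∈ interiorSet u) : deriv u ξ < 0 := hu.deriv_neg hDpos hh hg hc hξ
  have hd (v : ℝ) (hv : v ∈ Ioo (0 : ℝ) 1) :=
    hu.hasDerivAt_fluxProfile hp hDpos (hu.strictAntiOn hDpos hh hg hc) hneg hv
  refine ⟨⟨fun v hv => ContinuousAt.continuousWithinAt ?_, hd⟩, indicator_of_notMem (by simp) _,
    indicator_of_notMem (by simp) _, fun v hv => hu.fluxProfile_pos hDpos hneg hv⟩
  rcases hv.1.eq_or_lt with rfl | h0
  · exact hu.continuousAt_fluxProfile (by simp) hu.flux_tendsto_zero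
  rcases hv.2.eq_or_lt with rfl | h1
  · exact hu.continuousAt_fluxProfile (by simp) hu.flux_tendsto_one
  exact (hd v ⟨h0, h1⟩).continuousAt

end IsSolution

end ProfileOfSolution

section Translation

lemma le_of_antitone_of_apply_eq {a b : ℝ} {u₁ u₂ X : ℝ → ℝ} (h₁ : Antitone u₁) (h₂ : Antitone u₂)
    (hb : ∀ ξ, u₁ ξ ≤ b) (ha : ∀ ξ, a ≤ u₂ ξ) (hX₁ : ∀ v ∈ Ioo a b, u₁ (X v) = v)
    (hX₂ : ∀ v ∈ Ioo a b, u₂ (X v) = v) : u₁ ≤ u₂ := by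
  intro ξ
  by_contra! hlt
  obtain ⟨v, hv, hvu⟩ := exists_between hlt
  obtain ⟨w, hvw, hw⟩ := exists_between hvu
  have hvI : v ∈ Ioo a b := ⟨(ha ξ).trans_lt hv, hvu.trans_le (hb ξ)⟩
  have hwI : w ∈ Ioo a b := ⟨hvI.1.trans hvw, hw.trans_le (hb ξ)⟩
  have hlt_w : ξ < X w := h₁.reflect_lt ((hX₁ w hwI).trans_lt hw)
  have hv_lt : X v < ξ := h₂.reflect_lt (hv.trans_eq (hX₂ v hvI).symm)
  have hwv := h₁ (hv_lt.trans hlt_w).le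
  rw [hX₁ w hwI, hX₁ v hvI] at hwv
  exact hvw.not_ge hwv

/- The profile determines the derivative of the inverse function `X`, hence `X` up to a constant. -/
theorem IsSolution.exists_translation {p θ c : ℝ} {D h g u₁ u₂ : ℝ → ℝ}
    (hu₁ : IsSolution p D h g c u₁) (hu₂ : IsSolution p D h g c u₂) (hp : 1 < p)
    (hD : ContinuousOn D (Ioo 0 1)) (hDpos : ∀ v ∈ Ioo (0 : ℝ) 1, 0 < D v)
    (hh : ContinuousOn h (Icc 0 1)) (hg : IsReaction θ g) (hc : -hMin h < c) :
    ∃ a, ∀ ξ, u₂ ξ = u₁ (ξ + a) := by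
  have hXd {u : ℝ → ℝ} (hu : IsSolution p D h g c u) {v : ℝ} (hv : v ∈ Ioo (0 : ℝ) 1) :
      HasDerivAt (Function.invFun u) (-waveSlope p D (fluxProfile p D u) v)⁻¹ v := by
    have hneg (ξ : ℝ) (hξ : ξ ∈ interiorSet u) := hu.deriv_neg hDpos hh hg hc hξ
    rw [← hu.deriv_invFun hp hDpos hneg hv]
    exact hu.hasDerivAt_invFun (hu.strictAntiOn hDpos hh hg hc) hneg hv
  have hW : EqOn (fluxProfile p D u₁) (fluxProfile p D u₂) (Icc 0 1) :=
    (hu₁.isFluxProfile hp hDpos hh hg hc).eqOn (hu₂.isFluxProfile hp hDpos hh hg hc)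
      (one_lt_conjExponent hp) (hg.weight hD hDpos)
  obtain ⟨a, ha⟩ := isOpen_Ioo.exists_eq_add_of_deriv_eq isPreconnected_Ioo
    (fun v hv => (hXd hu₁ hv).differentiableAt.differentiableWithinAt)
    (fun v hv => (hXd hu₂ hv).differentiableAt.differentiableWithinAt) fun v hv => by
      rw [(hXd hu₁ hv).deriv, (hXd hu₂ hv).deriv, waveSlope, hW (Ioo_subset_Icc_self hv), waveSlope]
  have h₁ : Antitone fun ξ => u₁ (ξ + a) :=
    (hu₁.antitone hDpos hh hg hc).comp_monotone fun _ _ h => add_le_add_left h a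
  have h₂ := hu₂.antitone hDpos hh hg hc
  have hX₁ : ∀ v ∈ Ioo (0 : ℝ) 1, u₁ (Function.invFun u₂ v + a) = v := fun v hv =>
    (congrArg u₁ (ha hv)).symm.trans (hu₁.apply_invFun hv)
  have hX₂ : ∀ v ∈ Ioo (0 : ℝ) 1, u₂ (Function.invFun u₂ v) = v := fun v hv => hu₂.apply_invFun hv
  refine ⟨a, fun ξ => le_antisymm ?_ ?_⟩
  · exact le_of_antitone_of_apply_eq h₂ h₁ (fun ξ => (hu₂.mem_Icc ξ).2)
      (fun ξ => (hu₁.mem_Icc _).1) hX₂ hX₁ ξ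
  · exact le_of_antitone_of_apply_eq h₁ h₂ (fun ξ => (hu₁.mem_Icc _).2)
      (fun ξ => (hu₂.mem_Icc ξ).1) hX₁ hX₂ ξ

end Translation

section Constant

lemma two_sub_mul_one_add_rpow_lt {q t : ℝ} (hq1 : 1 < q) (hq2 : q < 2) (ht : 0 < t) :
    (2 - q) * (1 + t) ^ q < 1 + q * t + t ^ q := by
  have hconvex : (1 + t) ^ q ≤ 2 ^ (q - 1) * (1 ^ q + t ^ q) := by
    lift t to NNReal using ht.le
    exact_mod_cast NNReal.rpow_add_le_mul_rpow_add_rpow 1 t hq1.le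
  have hexp : 2 - q ≤ (2 : ℝ) ^ (1 - q) := by
    rw [Real.rpow_def_of_pos two_pos]
    nlinarith [Real.add_one_le_exp (Real.log 2 * (1 - q)), Real.log_two_lt_d9]
  have hmul : (2 : ℝ) ^ (1 - q) * 2 ^ (q - 1) = 1 := by
    rw [← Real.rpow_add two_pos, sub_add_sub_cancel', sub_self, Real.rpow_zero]
  calc (2 - q) * (1 + t) ^ q ≤ 2 ^ (1 - q) * (2 ^ (q - 1) * (1 ^ q + t ^ q)) := by gcongr
    _ = 1 + t ^ q := by rw [← mul_assoc, hmul, one_mul, Real.one_rpow]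
    _ < 1 + q * t + t ^ q := by linarith [mul_pos (zero_lt_one.trans hq1) ht]

lemma kConst_mem_Ioo {p : ℝ} (hp : 1 < p) : kConst p ∈ Ioo 0 (Real.conjExponent p) := by
  have hq := one_lt_conjExponent hp
  have hconj := (Real.HolderConjugate.conjExponent hp).mul_eq_add
  unfold kConst
  set q := Real.conjExponent p
  rcases lt_trichotomy p 2 with hp2 | rfl | hp2
  · have hq2 : 1 < q - 1 := by nlinarith
    have hpow : (2 : ℝ) < 2 ^ (q - 1) := by
      simpa only [Real.rpow_one] using Real.rpow_lt_rpow_of_exponent_lt one_lt_two hq2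
    rw [if_pos hp2]
    refine ⟨one_div_pos.2 (by linarith), ?_⟩
    rw [div_lt_iff₀ (by linarith)]
    nlinarith
  · rw [if_neg (lt_irrefl _), if_pos rfl]
    exact ⟨zero_lt_one, hq⟩
  · have hq2 : q < 2 := by nlinarith
    have hq1 : 0 < q - 1 := sub_pos.2 hq
    have hpow : (q - 1) ^ (q / (q - 2)) = ((q - 1) ^ (1 / (q - 2))) ^ q := by
      rw [← Real.rpow_mul hq1.le, one_div_mul_eq_div]
    have ht : 0 < (q - 1) ^ (1 / (q - 2)) := Real.rpow_pos_of_pos hq1 _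
    have hden := (lt_div_iff₀ (by positivity)).2 (two_sub_mul_one_add_rpow_lt hq hq2 ht)
    rw [if_neg hp2.not_gt, if_neg hp2.ne', hpow]
    exact ⟨div_pos (by linarith) (by linarith), div_lt_self (by linarith) (by linarith)⟩

lemma kConst_mul_rpow_lt {p I : ℝ} (hp : 1 < p) (hI : 0 < I) :
    (kConst p * I) ^ (1 / Real.conjExponent p) <
      (Real.conjExponent p * I) ^ (1 / Real.conjExponent p) := by
  have hk := kConst_mem_Ioo hp
  exact Real.rpow_lt_rpow (mul_pos hk.1 hI).le (mul_lt_mul_of_pos_right hk.2 hI)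
    (one_div_pos.2 (hk.1.trans hk.2))

end Constant

end CombustionWave

theorem theorem2_general {p θ : ℝ} {D h g : ℝ → ℝ} (hp : 1 < p)
    (hD : ContinuousOn D (Ioo 0 1)) (hDpos : ∀ v ∈ Ioo (0 : ℝ) 1, 0 < D v)
    (hh : ContinuousOn h (Icc 0 1)) (hg : IsReaction θ g)
    (hint : IntegrableOn (weight p D g) (Ioo 0 1))
    (hex : fluxH h 1 < hMin h + (Real.conjExponent p * ∫ v in (0 : ℝ)..1, weight p D g v) ^
      (1 / Real.conjExponent p)) :
    ∃ c : ℝ, -hMin h < c ∧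
      (∃ u : ℝ → ℝ, IsSolution p D h g c u) ∧
      (∀ c' : ℝ, -hMin h < c' → (∃ u : ℝ → ℝ, IsSolution p D h g c' u) → c' = c) ∧
      (∀ u₁ u₂ : ℝ → ℝ, IsSolution p D h g c u₁ → IsSolution p D h g c u₂ →
        ∃ a : ℝ, ∀ ξ : ℝ, u₂ ξ = u₁ (ξ + a)) ∧
      (∀ u : ℝ → ℝ, IsSolution p D h g c u → StrictAntiOn u (interiorSet u)) ∧
      c < 1 / θ * ((Real.conjExponent p * ∫ v in (0 : ℝ)..1, weight p D g v) ^
        (1 / Real.conjExponent p) - fluxH h θ) := by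
  have hq := one_lt_conjExponent hp
  have hf := hg.weight (p := p) hD hDpos
  have hfi := (intervalIntegrable_iff_integrableOn_Ioo_of_le zero_le_one).2 hint
  obtain ⟨c, W, hc, hW, hcθ⟩ := exists_isFluxProfile hq hh hf hfi hex
  refine ⟨c, hc, hW.exists_isSolution hp hD hDpos, ?_, ?_, ?_, ?_⟩
  · rintro c' hc' ⟨u, hu⟩
    exact (hu.isFluxProfile hp hDpos hh hg hc').speed_unique hW hq hh hf
  · exact fun u₁ u₂ hu₁ hu₂ => hu₁.exists_translation hu₂ hp hD hDpos hh hg hc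
  · exact fun u hu => hu.strictAntiOn hDpos hh hg hc
  · rw [one_div_mul_eq_div, lt_div_iff₀ hg.mem.1, lt_sub_iff_add_lt]
    exact hcθ

theorem theorem2 (p θ : ℝ) (D h g : ℝ → ℝ)
    (hp : 1 < p) (hθ : θ ∈ Ioo (0 : ℝ) 1)
    (hD : ContDiffOn ℝ 1 D (Ioo 0 1)) (hDpos : ∀ v ∈ Ioo (0 : ℝ) 1, 0 < D v)
    (hh : ContinuousOn h (Icc 0 1))
    (hg : ContinuousOn g (Icc 0 1)) (hg0 : ∀ v ∈ Icc 0 θ, g v = 0)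
    (hgpos : ∀ v ∈ Ioo θ 1, 0 < g v) (hg1 : g 1 = 0)
    (hint : IntegrableOn (weight p D g) (Ioo 0 1))
    (hex : fluxH h 1 ≤
      hMin h + (kConst p * ∫ v in (0 : ℝ)..1, weight p D g v) ^ (1 / Real.conjExponent p)) :
    ∃ c : ℝ, -hMin h < c ∧
      (∃ u : ℝ → ℝ, IsSolution p D h g c u) ∧
      (∀ c' : ℝ, -hMin h < c' → (∃ u : ℝ → ℝ, IsSolution p D h g c' u) → c' = c) ∧
      (∀ u₁ u₂ : ℝ → ℝ, IsSolution p D h g c u₁ → IsSolution p D h g c u₂ →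
        ∃ a : ℝ, ∀ ξ : ℝ, u₂ ξ = u₁ (ξ + a)) ∧
      (∀ u : ℝ → ℝ, IsSolution p D h g c u → StrictAntiOn u (interiorSet u)) ∧
      c < 1 / θ *
        ((Real.conjExponent p * ∫ v in (0 : ℝ)..1, weight p D g v) ^ (1 / Real.conjExponent p) - fluxH h θ) := by
  have hg' : IsReaction θ g :=
    ⟨hθ, hg.mono Ioo_subset_Icc_self, fun v hv => hg0 v (Ioc_subset_Icc_self hv), hgpos⟩
  have hI := (hg'.weight (p := p) hD.continuousOn hDpos).integral_pos
    ((intervalIntegrable_iff_integrableOn_Ioo_of_le zero_le_one).2 hint)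
  exact theorem2_general hp hD.continuousOn hDpos hh hg' hint
    (hex.trans_lt (add_lt_add_right (kConst_mul_rpow_lt hp hI) _))
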